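/- Let $n\ge 0$ be an integer and let $(W_i)_{i\in I}$ be a countable family of linear subspaces of $\mathbb{R}^n$, where $W_i$ has codimension $l_i\in\{0,1,\dots,n\}$. Then for every real $d\in[0,n]$ there exists a non-empty compact set $C\subset\mathbb{R}^n$ of Hausdorff dimension $d$ such that, for each $i\in I$, the orthogonal projection of $C$ onto $W_i$ has Hausdorff dimension $\max(0,d-l_i)$. -/

import Mathlib

open MeasureTheory Set
open scoped ENNReal NNReal

/-! For `0 < d < n` the set is a decreasing intersection of supports of densities. One step, for a
subspace `W` of dimension `m > 0` and codimension `l`, multiplies the current density by a function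
of the `W`-coordinates alone: a product of mean-one `s`-periodic weights living within `r` of `sℤ`.
With `e = max 0 (d - l)` and `s ^ m` slightly smaller than `r ^ e`, the projected support needs
about `s ^ (-m)` balls of radius comparable to `r`, which makes its dimension nearly `e`. Since `d ≤
l + e`, the weight still gives every `ρ`-ball mass `O(ρ ^ d)`.

The difficulty is to keep one Frostman bound through infinitely many steps (`exists_refinement`). At
large scales the oscillation is too fine to be noticed, so masses change by a summable error. At
small scales the implied constant, which depends on the previous density, is absorbed by the
logarithm in `logGauge`; the loss is not cumulative.

Each subspace is treated infinitely often, which gives the upper bounds (`dimH_le_of_hasFineCover`).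
For the lower bounds, a `ρ`-tube over a ball of `W` meets the unit ball in `O(ρ ^ (-l))` balls, so
the projected masses have every exponent below `d - l`, and a mass distribution argument applies
(`hausdorffMeasure_image_iInter_ne_zero`). Adding the whole space to the family yields the dimension
of the set itself. -/

lemma lintegral_ofReal_prod_pi {ι : Type*} [Fintype ι] (μ : ι → Measure ℝ) [∀ i, SigmaFinite (μ i)]
    (f : ι → ℝ → ℝ) (hf : ∀ i x, 0 ≤ f i x) (hi : ∀ i, Integrable (f i) (μ i)) :
    ∫⁻ x, ENNReal.ofReal (∏ i, f i (x i)) ∂(Measure.pi μ) =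
      ∏ i, ENNReal.ofReal (∫ y, f i y ∂(μ i)) := by
  rw [← ofReal_integral_eq_lintegral_ofReal (Integrable.fintype_prod hi)
    (Filter.Eventually.of_forall fun x => Finset.prod_nonneg fun i _ => hf i _),
    integral_fintype_prod_eq_prod, ENNReal.ofReal_prod_of_nonneg]
  exact fun i _ => integral_nonneg (hf i)

/-! ### Periodic weights of mean one. -/

/-- A nonnegative continuous `s`-periodic function of mean one. -/
structure IsMeanOne (h : ℝ → ℝ) (s : ℝ) : Prop where
  cont : Continuous h
  nonneg : ∀ u, 0 ≤ h u
  periodic : Function.Periodic h s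
  integral_eq : ∫ u in (0 : ℝ)..s, h u = s

lemma isMeanOne_one (s : ℝ) : IsMeanOne (fun _ => 1) s :=
  ⟨continuous_const, fun _ => zero_le_one, fun _ => rfl, by simp⟩

lemma IsMeanOne.integral_add {h : ℝ → ℝ} {s : ℝ} (hh : IsMeanOne h s) (a : ℝ) :
    ∫ u in (0 : ℝ)..s, h (a + u) = s := by
  rw [intervalIntegral.integral_comp_add_left (f := h), add_zero,
    hh.periodic.intervalIntegral_add_eq a 0, zero_add, hh.integral_eq]

/-- Nonnegativity allows the interval to be lengthened to `⌈t / s⌉` whole periods. -/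
lemma IsMeanOne.integral_le {h : ℝ → ℝ} {s : ℝ} (hh : IsMeanOne h s) (hs : 0 < s) (a : ℝ) {t : ℝ}
    (ht : 0 ≤ t) : ∫ u in a..(a + t), h u ≤ t + s := by
  have hi : ∀ x y, IntervalIntegrable h volume x y := fun x y => hh.cont.intervalIntegrable x y
  have h1 : t ≤ (⌈t / s⌉ : ℤ) • s := by
    rw [zsmul_eq_mul]
    exact (div_le_iff₀ hs).1 (Int.le_ceil _)
  calc ∫ u in a..(a + t), h u ≤ ∫ u in a..(a + (⌈t / s⌉ : ℤ) • s), h u := by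
        apply intervalIntegral.integral_mono_interval le_rfl (by linarith) (by linarith)
          (Filter.Eventually.of_forall hh.nonneg) (hi _ _)
    _ = (⌈t / s⌉ : ℤ) • s := by
        rw [hh.periodic.intervalIntegral_add_zsmul_eq _ _ hi,
          hh.periodic.intervalIntegral_add_eq a 0, zero_add, hh.integral_eq]
    _ ≤ t + s := by
        rw [zsmul_eq_mul]
        have := (Int.ceil_lt_add_one (t / s)).le
        calc (⌈t / s⌉ : ℝ) * s ≤ (t / s + 1) * s := by gcongr
          _ = t + s := by field_simp

/-- A tent of height `r` around `sℤ`, rescaled to mean one. Integrating over `[0, r / 2]` alone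
already gives at least `r ^ 2 / 4`, whence the bound `4 * s / r`. -/
lemma exists_isMeanOne {r s : ℝ} (hr : 0 < r) (hrs : r ≤ s) :
    ∃ h : ℝ → ℝ, IsMeanOne h s ∧ (∀ u, h u ≤ 4 * s / r) ∧
      ∀ u, h u ≠ 0 → ‖(u : AddCircle s)‖ ≤ r := by
  have hs : 0 < s := hr.trans_le hrs
  set k : ℝ → ℝ := fun u => max 0 (r - ‖(u : AddCircle s)‖) with hk
  have hkc : Continuous k :=
    continuous_const.max (continuous_const.sub (AddCircle.continuous_mk' s).norm)
  have hk0 : ∀ u, 0 ≤ k u := fun u => le_max_left _ _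
  have hkr : ∀ u, k u ≤ r := fun u => max_le hr.le (by linarith [norm_nonneg (u : AddCircle s)])
  set J := ∫ u in (0 : ℝ)..s, k u with hJ
  have hJ' : r ^ 2 / 4 ≤ J := by
    calc r ^ 2 / 4 = ∫ u in (0 : ℝ)..(r / 2), (r / 2) := by
          rw [intervalIntegral.integral_const, smul_eq_mul]; ring
      _ ≤ ∫ u in (0 : ℝ)..(r / 2), k u := by
          apply intervalIntegral.integral_mono_on (by linarith) (by simp)
            (hkc.intervalIntegrable _ _)
          intro u hu
          have h1 : ‖(u : AddCircle s)‖ = |u| := by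
            rw [AddCircle.norm_coe_eq_abs_iff _ hs.ne', abs_of_nonneg hu.1, abs_of_pos hs]
            linarith [hu.2]
          refine le_max_of_le_right ?_
          rw [h1, abs_of_nonneg hu.1]; linarith [hu.2]
      _ ≤ J := intervalIntegral.integral_mono_interval le_rfl (by linarith) (by linarith)
          (Filter.Eventually.of_forall hk0) (hkc.intervalIntegrable _ _)
  have hJ0 : 0 < J := lt_of_lt_of_le (by positivity) hJ'
  refine ⟨fun u => s / J * k u, ⟨by fun_prop, fun u => by have := hk0 u; positivity, ?_, ?_⟩, ?_, ?_⟩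
  · intro u
    simp only [hk, AddCircle.coe_add_period]
  · rw [intervalIntegral.integral_const_mul, ← hJ]; field_simp
  · intro u
    calc s / J * k u ≤ s / (r ^ 2 / 4) * r := by
          gcongr
          exact hkr u
      _ = 4 * s / r := by field_simp
  · intro u hu
    by_contra! hc
    exact hu (by simp only [hk]; rw [max_eq_left (by linarith), mul_zero])

/-! ### Product densities in orthonormal coordinates. -/

section Density

variable {ι E : Type*} [Fintype ι] [NormedAddCommGroup E] [InnerProductSpace ℝ E]

/-- The product of functions of the coordinates in an orthonormal basis. -/
noncomputable def coordProd (b : OrthonormalBasis ι ℝ E) (q : ι → ℝ → ℝ) (x : E) : ℝ :=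
  ∏ j, q j (b.repr x j)

lemma coordProd_nonneg (b : OrthonormalBasis ι ℝ E) {q : ι → ℝ → ℝ} (hq : ∀ j u, 0 ≤ q j u) (x : E) :
    0 ≤ coordProd b q x := Finset.prod_nonneg fun j _ => hq j _

lemma continuous_coordProd (b : OrthonormalBasis ι ℝ E) {q : ι → ℝ → ℝ}
    (hq : ∀ j, Continuous (q j)) : Continuous (coordProd b q) := by
  refine continuous_finsetProd _ fun j _ => (hq j).comp ?_
  simp only [b.repr_apply_apply]
  fun_prop

/-- The vector with given coordinates. -/
noncomputable def ofCoords (b : OrthonormalBasis ι ℝ E) (u : ι → ℝ) : E :=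
  b.repr.symm (WithLp.toLp 2 u)

lemma repr_ofCoords (b : OrthonormalBasis ι ℝ E) (u : ι → ℝ) (j : ι) :
    b.repr (ofCoords b u) j = u j := by
  simp [ofCoords]

lemma norm_le_sum_abs_repr (b : OrthonormalBasis ι ℝ E) (x : E) : ‖x‖ ≤ ∑ j, |b.repr x j| := by
  conv_lhs => rw [← b.sum_repr x]
  refine (norm_sum_le _ _).trans (Finset.sum_le_sum fun j _ => ?_)
  rw [norm_smul, b.norm_eq_one, mul_one, Real.norm_eq_abs]

lemma norm_le_card_mul (b : OrthonormalBasis ι ℝ E) {x : E} {c : ℝ} (h : ∀ j, |b.repr x j| ≤ c) :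
    ‖x‖ ≤ Fintype.card ι * c := by
  refine (norm_le_sum_abs_repr b x).trans ((Finset.sum_le_sum fun j _ => h j).trans ?_)
  simp

lemma abs_repr_le_norm (b : OrthonormalBasis ι ℝ E) (x : E) (j : ι) : |b.repr x j| ≤ ‖x‖ := by
  rw [← b.repr.norm_map x]
  exact PiLp.norm_apply_le (b.repr x) j

lemma continuous_ofCoords (b : OrthonormalBasis ι ℝ E) : Continuous (ofCoords b) :=
  b.repr.symm.continuous.comp (PiLp.continuous_toLp 2 _)

lemma lintegral_coordProd_add {b : OrthonormalBasis ι ℝ E} {q : ι → ℝ → ℝ} {s : ℝ} (hs : 0 < s)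
    (hq : ∀ j, IsMeanOne (q j) s) (x : E) :
    ∫⁻ u in Set.pi univ (fun _ : ι => Ioc (0 : ℝ) s),
      ENNReal.ofReal (coordProd b q (x + ofCoords b u)) = ENNReal.ofReal s ^ Fintype.card ι := by
  have h1 : ∀ u, coordProd b q (x + ofCoords b u) = ∏ j, q j (b.repr x j + u j) := by
    intro u
    simp [coordProd, repr_ofCoords]
  simp_rw [h1]
  rw [volume_pi, Measure.restrict_pi_pi,
    lintegral_ofReal_prod_pi _ fun j y => q j (b.repr x j + y)]
  · simp_rw [← intervalIntegral.integral_of_le hs.le, (hq _).integral_add]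
    simp
  · exact fun j y => (hq j).nonneg _
  · intro j
    have := ((hq j).cont.comp (continuous_const.add continuous_id)).intervalIntegrable
      (μ := volume) (a := 0) (b := s) (u := fun y => q j (b.repr x j + y))
    exact (intervalIntegrable_iff_integrableOn_Ioc_of_le hs.le).1 this

variable [FiniteDimensional ℝ E] [MeasurableSpace E] [BorelSpace E]

/-- Averaging the translates of the weight over one period cell gives the constant one. Moving the
weight by a vector of the cell costs only the passage from `F` to `F'`, so each translated integral
obeys the comparison, and hence so does the average. -/
lemma lintegral_coordProd_comparison {b : OrthonormalBasis ι ℝ E} {q : ι → ℝ → ℝ} {s : ℝ}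
    (hs : 0 < s) (hq : ∀ j, IsMeanOne (q j) s) {F F' : E → ℝ≥0∞} (hF : Measurable F)
    (hF' : Measurable F') (hFF' : ∀ x v, ‖v‖ ≤ Fintype.card ι * s → F x ≤ F' (x + v)) :
    ∫⁻ x, F x * ENNReal.ofReal (coordProd b q x) ≤ ∫⁻ x, F' x ∧
    ∫⁻ x, F x ≤ ∫⁻ x, F' x * ENNReal.ofReal (coordProd b q x) := by
  set G : E → ℝ≥0∞ := fun x => ENNReal.ofReal (coordProd b q x) with hG
  have hGm : Measurable G :=
    (continuous_coordProd b fun j => (hq j).cont).measurable.ennreal_ofReal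
  set B : Set (ι → ℝ) := Set.pi univ (fun _ : ι => Ioc (0 : ℝ) s) with hB
  set S : ℝ≥0∞ := ENNReal.ofReal s ^ Fintype.card ι with hS
  have hS0 : S ≠ 0 := pow_ne_zero _ (by simpa using hs)
  have hSt : S ≠ ∞ := ENNReal.pow_ne_top ENNReal.ofReal_ne_top
  have hvol : volume B = S := by
    rw [hB, volume_pi_pi]; simp [hS]
  have hBm : MeasurableSet B := MeasurableSet.univ_pi fun _ => measurableSet_Ioc
  have hkey : ∀ x, ∫⁻ u in B, G (x + ofCoords b u) = S := fun x => lintegral_coordProd_add hs hq x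
  have hv : ∀ u ∈ B, ‖ofCoords b u‖ ≤ Fintype.card ι * s := by
    intro u hu
    refine norm_le_card_mul b fun j => ?_
    rw [repr_ofCoords, abs_of_pos (hu j trivial).1]
    exact (hu j trivial).2
  have hm2 : Measurable fun p : (ι → ℝ) × E => p.2 + ofCoords b p.1 :=
    (continuous_snd.add ((continuous_ofCoords b).comp continuous_fst)).measurable
  have hswap : ∀ H : E → ℝ≥0∞, Measurable H →
      ∫⁻ u in B, ∫⁻ y, H y * G (y + ofCoords b u) = S * ∫⁻ y, H y := by
    intro H hH
    rw [lintegral_lintegral_swap]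
    · have : ∀ y, ∫⁻ u in B, H y * G (y + ofCoords b u) = S * H y := by
        intro y
        rw [lintegral_const_mul, hkey, mul_comm]
        exact hGm.comp (continuous_const.add (continuous_ofCoords b)).measurable
      simp_rw [this]
      rw [lintegral_const_mul _ hH]
    · exact ((hH.comp measurable_snd).mul (hGm.comp hm2)).aemeasurable
  have hconst : ∀ c : ℝ≥0∞, ∫⁻ _ in B, c = S * c := by
    intro c; rw [setLIntegral_const, hvol, mul_comm]
  constructor
  · rw [← ENNReal.mul_le_mul_iff_right hS0 hSt, ← hswap F' hF', ← hconst]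
    refine setLIntegral_mono' hBm fun u hu => ?_
    rw [← lintegral_add_right_eq_self (fun x => F x * G x) (ofCoords b u)]
    refine lintegral_mono fun y => mul_le_mul_left ?_ _
    have := hFF' (y + ofCoords b u) (-ofCoords b u) (by rw [norm_neg]; exact hv u hu)
    simpa using this
  · rw [← ENNReal.mul_le_mul_iff_right hS0 hSt, ← hswap F hF, ← hconst]
    refine setLIntegral_mono' hBm fun u hu => ?_
    rw [← lintegral_add_right_eq_self (fun x => F' x * G x) (ofCoords b u)]
    refine lintegral_mono fun y => mul_le_mul_left ?_ _
    exact hFF' y _ (hv u hu)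

lemma setLIntegral_closedBall_coordProd_le {b : OrthonormalBasis ι ℝ E} {q : ι → ℝ → ℝ}
    (hc : ∀ j, Continuous (q j)) (hq : ∀ j u, 0 ≤ q j u) (x : E) {ρ : ℝ} (hρ : 0 ≤ ρ) :
    ∫⁻ y in Metric.closedBall x ρ, ENNReal.ofReal (coordProd b q y) ≤
      ∏ j, ENNReal.ofReal (∫ u in (b.repr x j - ρ)..(b.repr x j + ρ), q j u) := by
  set B : Set (ι → ℝ) := Set.pi univ (fun j : ι => Icc (b.repr x j - ρ) (b.repr x j + ρ)) with hB
  set T : E → ι → ℝ := fun y => WithLp.ofLp (b.repr y) with hT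
  have hTm : MeasurePreserving T volume volume :=
    (PiLp.volume_preserving_ofLp ι).comp b.measurePreserving_repr
  have hBm : MeasurableSet B := MeasurableSet.univ_pi fun _ => measurableSet_Icc
  have hsub : Metric.closedBall x ρ ⊆ T ⁻¹' B := by
    intro y hy j _
    have h1 := (abs_repr_le_norm b (y - x) j).trans (mem_closedBall_iff_norm.1 hy)
    rw [map_sub, PiLp.sub_apply, abs_le] at h1
    exact ⟨by simp only [hT]; linarith [h1.1], by simp only [hT]; linarith [h1.2]⟩
  have hm : Measurable fun z : ι → ℝ => ENNReal.ofReal (∏ j, q j (z j)) :=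
    (continuous_finsetProd _ fun j _ => (hc j).comp (continuous_apply j)).measurable.ennreal_ofReal
  calc ∫⁻ y in Metric.closedBall x ρ, ENNReal.ofReal (coordProd b q y)
      ≤ ∫⁻ y in T ⁻¹' B, ENNReal.ofReal (coordProd b q y) := lintegral_mono_set hsub
    _ = ∫⁻ z in B, ENNReal.ofReal (∏ j, q j (z j)) :=
        hTm.setLIntegral_comp_preimage hBm hm
    _ = _ := by
        rw [hB, volume_pi, Measure.restrict_pi_pi, lintegral_ofReal_prod_pi]
        · refine Finset.prod_congr rfl fun j _ => ?_
          rw [intervalIntegral.integral_of_le (by linarith), integral_Icc_eq_integral_Ioc]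
        · exact fun j y => hq j _
        · intro j
          exact (hc j).continuousOn.integrableOn_Icc

end Density

/-! ### Choice of scales and the ball estimate. -/

-- Take `s = r ^ c` with `s ^ m = r ^ (e + κ / 2)`, halfway between the two requirements: the spare
-- factor `r ^ (κ / 2)` kills the constants as `r → 0`.
open Filter Topology in
lemma exists_scales {m : ℕ} {e κ η K : ℝ} (he : 0 ≤ e) (hκ : 0 < κ) (hm : e + κ ≤ m) (hη : 0 < η)
    (hK : 0 ≤ K) : ∃ r s : ℝ, 0 < r ∧ r ≤ s ∧ s ≤ η ∧ s ^ m ≤ r ^ e ∧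
      (5 / s) ^ m * (K * r) ^ (e + κ) ≤ 1 := by
  have hm0 : (0 : ℝ) < m := by linarith
  set c := (e + κ / 2) / m with hc
  have hc0 : 0 < c := by positivity
  have hc1 : c ≤ 1 := by rw [hc, div_le_one hm0]; linarith
  have ht : ∀ a : ℝ, 0 < a → Tendsto (fun r : ℝ => r ^ a) (𝓝[>] 0) (𝓝 0) := by
    intro a ha
    have := (Real.continuousAt_rpow_const 0 a (Or.inr ha.le)).tendsto
    rw [Real.zero_rpow ha.ne'] at this
    exact this.mono_left nhdsWithin_le_nhds
  have h1 : ∀ᶠ r : ℝ in 𝓝[>] 0, r ^ c ≤ η := (ht c hc0).eventually_le_const hη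
  have h2 : ∀ᶠ r : ℝ in 𝓝[>] 0, 5 ^ m * K ^ (e + κ) * r ^ (κ / 2) ≤ 1 := by
    have := (ht (κ / 2) (by linarith)).const_mul (5 ^ m * K ^ (e + κ))
    rw [mul_zero] at this
    exact this.eventually_le_const one_pos
  have h3 : ∀ᶠ r : ℝ in 𝓝[>] 0, r ≤ 1 :=
    nhdsWithin_le_nhds (Iic_mem_nhds one_pos)
  obtain ⟨r, hr1, hr2, hr3, hr0⟩ := (h1.and (h2.and (h3.and self_mem_nhdsWithin))).exists
  have hr0 : 0 < r := hr0
  have hs : (r ^ c) ^ m = r ^ (e + κ / 2) := by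
    rw [← Real.rpow_natCast, ← Real.rpow_mul hr0.le, hc, div_mul_cancel₀ _ hm0.ne']
  refine ⟨r, r ^ c, hr0, ?_, hr1, ?_, ?_⟩
  · conv_lhs => rw [← Real.rpow_one r]
    exact Real.rpow_le_rpow_of_exponent_ge hr0 hr3 hc1
  · rw [hs]
    exact Real.rpow_le_rpow_of_exponent_ge hr0 hr3 (by linarith)
  · rw [div_pow, hs, Real.mul_rpow hK hr0.le]
    have : r ^ (e + κ) = r ^ (e + κ / 2) * r ^ (κ / 2) := by
      rw [← Real.rpow_add hr0]; ring_nf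
    rw [this]
    have h0 : r ^ (e + κ / 2) ≠ 0 := (Real.rpow_pos_of_pos hr0 _).ne'
    calc _ = 5 ^ m * K ^ (e + κ) * r ^ (κ / 2) := by field_simp
      _ ≤ 1 := hr2

/-- Here `A` bounds the integral of one weight over an interval of length `2 * ρ`. Three regimes:
for `s ≤ ρ` the weight looks uniform; for `r ≤ ρ ≤ s` only boundedly many peaks are seen, and `s ^ m
≤ r ^ e` is used; for `ρ ≤ r` the height of a peak decides. -/
lemma pow_mul_pow_le_rpow {m l : ℕ} {d e r s ρ A : ℝ} (hr : 0 < r) (hrs : r ≤ s)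
    (he : 0 ≤ e) (hem : e ≤ m) (hd : d ≤ l + e) (hsr : s ^ m ≤ r ^ e) (hρ : 0 < ρ)
    (hρ1 : ρ ≤ 1) (hA : 0 ≤ A) (hA1 : A ≤ 8 * ρ * s / r) (hA2 : A ≤ 2 * ρ + s) :
    A ^ m * (2 * ρ) ^ l ≤ 8 ^ (m + l) * ρ ^ d := by
  have hs : 0 < s := hr.trans_le hrs
  have key : A ^ m ≤ 8 ^ m * ρ ^ e := by
    rcases le_total s ρ with h1 | h1
    · calc A ^ m ≤ (8 * ρ) ^ m := by gcongr; linarith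
        _ = 8 ^ m * ρ ^ (m : ℝ) := by rw [mul_pow, Real.rpow_natCast]
        _ ≤ 8 ^ m * ρ ^ e := by
          gcongr ?_ * ?_
          exact Real.rpow_le_rpow_of_exponent_ge hρ hρ1 hem
    rcases le_total r ρ with h2 | h2
    · calc A ^ m ≤ (8 * s) ^ m := by gcongr; linarith
        _ = 8 ^ m * s ^ m := mul_pow ..
        _ ≤ 8 ^ m * ρ ^ e := by
          gcongr ?_ * ?_
          exact hsr.trans (Real.rpow_le_rpow hr.le h2 he)
    · calc A ^ m ≤ (8 * ρ * s / r) ^ m := by gcongr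
        _ = 8 ^ m * ((ρ / r) ^ m * s ^ m) := by rw [← mul_pow, ← mul_pow]; congr 1; ring
        _ ≤ 8 ^ m * ((ρ / r) ^ e * r ^ e) := by
          gcongr ?_ * (?_ * ?_)
          rw [← Real.rpow_natCast]
          exact Real.rpow_le_rpow_of_exponent_ge (by positivity) ((div_le_one hr).2 h2) hem
        _ = 8 ^ m * ρ ^ e := by
          rw [← Real.mul_rpow (by positivity) hr.le, div_mul_cancel₀ _ hr.ne']
  calc A ^ m * (2 * ρ) ^ l ≤ (8 ^ m * ρ ^ e) * (8 * ρ) ^ l := by gcongr; norm_num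
    _ = 8 ^ (m + l) * ρ ^ (l + e) := by
      rw [Real.rpow_add hρ, Real.rpow_natCast]; ring
    _ ≤ 8 ^ (m + l) * ρ ^ d := by
      gcongr ?_ * ?_
      exact Real.rpow_le_rpow_of_exponent_ge hρ hρ1 hd

/-! ### Fine covers of projections and covers of tubes. -/

/-- `A` is covered by finitely many balls of a common radius `R ≤ δ`, with `τ`-sum at most one. -/
def HasFineCover {X : Type*} [PseudoMetricSpace X] (A : Set X) (δ τ : ℝ) : Prop :=
  ∃ (c : Finset X) (R : ℝ), 0 ≤ R ∧ R ≤ δ ∧ A ⊆ ⋃ y ∈ c, Metric.closedBall y R ∧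
    c.card * (2 * R) ^ τ ≤ 1

lemma exists_int_abs_sub_mul_le {s r u : ℝ} (hs : 0 < s) (hrs : r ≤ s) (hs1 : s ≤ 1) (hu : |u| ≤ 1)
    (h : ‖(u : AddCircle s)‖ ≤ r) :
    ∃ k ∈ Finset.Icc (-⌊2 / s⌋) ⌊2 / s⌋, |u - k * s| ≤ r := by
  rw [AddCircle.norm_eq] at h
  refine ⟨_, ?_, h⟩
  set k := round (s⁻¹ * u)
  rw [abs_le] at h hu
  have h1 : (k : ℝ) ≤ 2 / s := by rw [le_div_iff₀ hs]; linarith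
  have h2 : ((-k : ℤ) : ℝ) ≤ 2 / s := by push_cast; rw [le_div_iff₀ hs]; linarith
  have := Int.le_floor.2 h1
  have := Int.le_floor.2 h2
  rw [Finset.mem_Icc]; omega

lemma card_Icc_floor_le {s : ℝ} (hs : 0 < s) (hs1 : s ≤ 1) :
    ((Finset.Icc (-⌊2 / s⌋) ⌊2 / s⌋).card : ℝ) ≤ 5 / s := by
  have h0 : 0 ≤ ⌊2 / s⌋ := Int.floor_nonneg.2 (by positivity)
  rw [Int.card_Icc]
  have : (((⌊2 / s⌋ + 1 - -⌊2 / s⌋).toNat : ℤ) : ℝ) = 2 * (⌊2 / s⌋ : ℝ) + 1 := by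
    rw [Int.toNat_of_nonneg (by omega)]; push_cast; ring
  rw [← Int.cast_natCast, this]
  have h1 := Int.floor_le (2 / s)
  have h2 : 1 ≤ 1 / s := (one_le_div hs).2 hs1
  calc _ ≤ 2 * (2 / s) + 1 / s := by linarith
    _ = 5 / s := by ring

section Adapted

variable {E : Type*} [NormedAddCommGroup E] [InnerProductSpace ℝ E] {m l : ℕ}

/-- An orthonormal basis whose left part lies in `W` and whose right part is orthogonal to `W`. -/
structure IsAdapted (b : OrthonormalBasis (Fin m ⊕ Fin l) ℝ E) (W : Submodule ℝ E) : Prop where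
  inl_mem : ∀ j, b (Sum.inl j) ∈ W
  inr_mem : ∀ j, b (Sum.inr j) ∈ Wᗮ

lemma exists_isAdapted [FiniteDimensional ℝ E] (W : Submodule ℝ E) (hm : Module.finrank ℝ W = m)
    (hl : Module.finrank ℝ (E ⧸ W) = l) :
    ∃ b : OrthonormalBasis (Fin m ⊕ Fin l) ℝ E, IsAdapted b W := by
  have hsum := W.finrank_quotient_add_finrank
  have hl' : Module.finrank ℝ Wᗮ = l := by
    have := W.finrank_add_finrank_orthogonal
    omega
  subst hm
  subst hl'
  set v : Fin (Module.finrank ℝ W) ⊕ Fin (Module.finrank ℝ Wᗮ) → E :=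
    Sum.elim (fun j => (stdOrthonormalBasis ℝ W j : E)) (fun j => (stdOrthonormalBasis ℝ Wᗮ j : E))
    with hv
  have hon : Orthonormal ℝ v := by
    constructor
    · rintro (j | j)
      · exact (stdOrthonormalBasis ℝ W).norm_eq_one j
      · exact (stdOrthonormalBasis ℝ Wᗮ).norm_eq_one j
    · rintro (i | i) (j | j) hij
      · exact (stdOrthonormalBasis ℝ W).orthonormal.2 fun h => hij (by rw [h])
      · exact Submodule.inner_right_of_mem_orthogonal (Subtype.prop _) (Subtype.prop _)
      · exact Submodule.inner_left_of_mem_orthogonal (Subtype.prop _) (Subtype.prop _)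
      · exact (stdOrthonormalBasis ℝ Wᗮ).orthonormal.2 fun h => hij (by rw [h])
  obtain ⟨b, hb⟩ := Orthonormal.exists_orthonormalBasis_extension_of_card_eq (𝕜 := ℝ) (v := v)
    (s := univ) (by simpa using W.finrank_add_finrank_orthogonal.symm)
    (hon.comp _ Subtype.val_injective)
  refine ⟨b, ⟨fun j => ?_, fun j => ?_⟩⟩ <;> rw [hb _ trivial] <;> exact Subtype.prop _

variable {b : OrthonormalBasis (Fin m ⊕ Fin l) ℝ E} {W : Submodule ℝ E}
  [W.HasOrthogonalProjection]

lemma IsAdapted.repr_inl (hb : IsAdapted b W) (x : E) (j : Fin m) :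
    b.repr (W.starProjection x) (Sum.inl j) = b.repr x (Sum.inl j) := by
  rw [b.repr_apply_apply, b.repr_apply_apply, ← Submodule.inner_starProjection_left_eq_right,
    Submodule.starProjection_eq_self_iff.2 (hb.inl_mem j)]

lemma IsAdapted.repr_inr (hb : IsAdapted b W) (x : E) (j : Fin l) :
    b.repr (W.starProjection x) (Sum.inr j) = 0 := by
  rw [b.repr_apply_apply]
  exact Submodule.inner_left_of_mem_orthogonal (Submodule.starProjection_apply_mem _ _)
    (hb.inr_mem j)

/-- Every projected point is coordinatewise within `r` of the grid `sℤ ^ m` in `W`, and at most `(5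
/ s) ^ m` grid points are relevant to the unit ball. -/
lemma IsAdapted.hasFineCover (hb : IsAdapted b W) {r s δ τ : ℝ} (hr : 0 < r) (hrs : r ≤ s)
    (hs1 : s ≤ 1) (hδ : (m + l) * r ≤ δ) (hsum : (5 / s) ^ m * (2 * (m + l) * r) ^ τ ≤ 1) {A : Set E}
    (hA : A ⊆ Metric.closedBall 0 1)
    (hAr : ∀ x ∈ A, ∀ j, ‖(b.repr x (Sum.inl j) : AddCircle s)‖ ≤ r) :
    HasFineCover (W.starProjection '' A) δ τ := by
  classical
  have hs : 0 < s := hr.trans_le hrs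
  set I := Finset.Icc (-⌊2 / s⌋) ⌊2 / s⌋ with hI
  set ctr : (Fin m → ℤ) → E := fun k => ofCoords b (Sum.elim (fun j => k j * s) fun _ => 0)
  refine ⟨(Fintype.piFinset fun _ : Fin m => I).image ctr, (m + l) * r, by positivity, hδ, ?_, ?_⟩
  · rintro _ ⟨x, hx, rfl⟩
    have h1 : ∀ j, ∃ k ∈ I, |b.repr x (Sum.inl j) - k * s| ≤ r := fun j =>
      exists_int_abs_sub_mul_le hs hrs hs1
        ((abs_repr_le_norm b x _).trans (mem_closedBall_zero_iff.1 (hA hx))) (hAr x hx j)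
    choose k hk hkr using h1
    rw [mem_iUnion₂]
    refine ⟨ctr k, Finset.mem_image_of_mem _ (Fintype.mem_piFinset.2 hk), ?_⟩
    rw [mem_closedBall_iff_norm]
    have := norm_le_card_mul b (x := W.starProjection x - ctr k) (c := r) ?_
    · simpa using this
    · rintro (j | j)
      · rw [map_sub, PiLp.sub_apply, hb.repr_inl, repr_ofCoords]
        exact hkr j
      · rw [map_sub, PiLp.sub_apply, hb.repr_inr, repr_ofCoords]
        simpa using hr.le
  · refine le_trans ?_ hsum
    rw [← mul_assoc]
    gcongr
    calc (((Fintype.piFinset fun _ : Fin m => I).image ctr).card : ℝ)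
        ≤ ((Fintype.piFinset fun _ : Fin m => I).card : ℝ) := by
          exact_mod_cast Finset.card_image_le
      _ = (I.card : ℝ) ^ m := by simp
      _ ≤ (5 / s) ^ m := by
          gcongr
          exact card_Icc_floor_le hs hs1

/-- The tube is already thin along `W`, so a `ρ`-grid is needed only in the `l` orthogonal
directions. -/
lemma IsAdapted.exists_tube_cover (hb : IsAdapted b W) {ρ : ℝ} (hρ : 0 < ρ) (hρ1 : ρ ≤ 1) (y : E) :
    ∃ c : Finset E, (c.card : ℝ) ≤ (5 / ρ) ^ l ∧
      Metric.closedBall 0 1 ∩ W.starProjection ⁻¹' Metric.closedBall y ρ ⊆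
        ⋃ z ∈ c, Metric.closedBall z ((m + l) * ρ) := by
  classical
  set I := Finset.Icc (-⌊2 / ρ⌋) ⌊2 / ρ⌋ with hI
  set ctr : (Fin l → ℤ) → E := fun k =>
    ofCoords b (Sum.elim (fun j => b.repr y (Sum.inl j)) fun j => k j * ρ)
  refine ⟨(Fintype.piFinset fun _ : Fin l => I).image ctr, ?_, ?_⟩
  · calc (((Fintype.piFinset fun _ : Fin l => I).image ctr).card : ℝ)
        ≤ ((Fintype.piFinset fun _ : Fin l => I).card : ℝ) := by
          exact_mod_cast Finset.card_image_le
      _ = (I.card : ℝ) ^ l := by simp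
      _ ≤ (5 / ρ) ^ l := by
          gcongr
          exact card_Icc_floor_le hρ hρ1
  · rintro x ⟨hx1, hxy⟩
    have h1 : ∀ j, ∃ k ∈ I, |b.repr x (Sum.inr j) - k * ρ| ≤ ρ := fun j => by
      refine exists_int_abs_sub_mul_le hρ le_rfl hρ1
        ((abs_repr_le_norm b x _).trans (mem_closedBall_zero_iff.1 hx1)) ?_
      refine (AddCircle.norm_le_half_period ρ hρ.ne').trans ?_
      rw [abs_of_pos hρ]; linarith
    choose k hk hkr using h1
    rw [mem_iUnion₂]
    refine ⟨ctr k, Finset.mem_image_of_mem _ (Fintype.mem_piFinset.2 hk), ?_⟩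
    rw [mem_closedBall_iff_norm]
    have := norm_le_card_mul b (x := x - ctr k) (c := ρ) ?_
    · simpa using this
    · rintro (j | j)
      · have h2 := (abs_repr_le_norm b (W.starProjection x - y) (Sum.inl j)).trans
          (mem_closedBall_iff_norm.1 hxy)
        rw [map_sub, PiLp.sub_apply, hb.repr_inl] at h2
        rw [map_sub, PiLp.sub_apply, repr_ofCoords]
        exact h2
      · rw [map_sub, PiLp.sub_apply, repr_ofCoords]
        exact hkr j

end Adapted

/-! ### One refinement step. -/

section Step

variable {E : Type*} [NormedAddCommGroup E]

/-- The tent function at `x` of radius `2ρ` and height two. -/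
noncomputable def tent (x : E) (ρ : ℝ) (y : E) : ℝ := max 0 (2 - ‖y - x‖ / ρ)

lemma tent_nonneg (x : E) (ρ : ℝ) (y : E) : 0 ≤ tent x ρ y := le_max_left _ _

lemma tent_le_two (x : E) {ρ : ℝ} (hρ : 0 < ρ) (y : E) : tent x ρ y ≤ 2 :=
  max_le zero_le_two (sub_le_self _ (by positivity))

lemma continuous_tent (x : E) (ρ : ℝ) : Continuous (tent x ρ) := by
  unfold tent; fun_prop

lemma one_le_tent {x : E} {ρ : ℝ} (hρ : 0 < ρ) {y : E} (hy : y ∈ Metric.closedBall x ρ) :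
    1 ≤ tent x ρ y := by
  refine le_max_of_le_right ?_
  have := (div_le_one hρ).2 (mem_closedBall_iff_norm.1 hy)
  linarith

lemma mem_closedBall_of_tent_ne_zero {x : E} {ρ : ℝ} (hρ : 0 < ρ) {y : E} (hy : tent x ρ y ≠ 0) :
    y ∈ Metric.closedBall x (2 * ρ) := by
  by_contra hc
  rw [mem_closedBall_iff_norm, not_le, ← lt_div_iff₀ hρ] at hc
  exact hy (max_eq_left (by linarith))

lemma tent_sub_le (x : E) {ρ : ℝ} (hρ : 0 < ρ) (y v : E) :
    tent x ρ y ≤ tent x ρ (y + v) + ‖v‖ / ρ := by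
  have h1 : ‖y + v - x‖ ≤ ‖y - x‖ + ‖v‖ := by
    calc ‖y + v - x‖ = ‖(y - x) + v‖ := by congr 1; abel
      _ ≤ _ := norm_add_le _ _
  have h2 : ‖y + v - x‖ / ρ ≤ ‖y - x‖ / ρ + ‖v‖ / ρ := by rw [← add_div]; gcongr
  unfold tent
  refine max_le (by positivity) ?_
  have := le_max_right 0 (2 - ‖y + v - x‖ / ρ)
  linarith

/-- The tent of radius `2 * ρ` has slope `1 / ρ ≤ 1 / ρ₀`, so a single `η` serves all centres and
all scales above `ρ₀`. -/
lemma exists_uniform_tent_mul {f : E → ℝ} (hf : UniformContinuous f) (hf0 : ∀ y, 0 ≤ f y) {M : ℝ}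
    (hM : 0 < M) (hfM : ∀ y, f y ≤ M) {ω ρ₀ : ℝ} (hω : 0 < ω) (hρ₀ : 0 < ρ₀) :
    ∃ η > 0, ∀ y v : E, ‖v‖ ≤ η → f y ≤ f (y + v) + ω ∧
      ∀ x ρ, ρ₀ ≤ ρ → tent x ρ y * f y ≤ tent x ρ (y + v) * f (y + v) + ω := by
  obtain ⟨ε, hε, h⟩ := Metric.uniformContinuous_iff.1 hf (ω / 4) (by linarith)
  refine ⟨min (ε / 2) (ω * ρ₀ / (2 * M)), by positivity, fun y v hv => ?_⟩
  have h1 : f y ≤ f (y + v) + ω / 4 := by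
    have h2 : dist y (y + v) < ε := by
      rw [dist_self_add_right]
      linarith [hv.trans (min_le_left _ _)]
    have := h h2
    rw [Real.dist_eq, abs_lt] at this
    linarith [this.2]
  refine ⟨by linarith, fun x ρ hρ => ?_⟩
  have hρ0 : 0 < ρ := hρ₀.trans_le hρ
  have h3 : ‖v‖ / ρ * M ≤ ω / 2 := by
    have h4 : ‖v‖ / ρ ≤ (ω * ρ₀ / (2 * M)) / ρ₀ := by
      gcongr
      exact hv.trans (min_le_right _ _)
    calc ‖v‖ / ρ * M ≤ (ω * ρ₀ / (2 * M)) / ρ₀ * M := by gcongr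
      _ = ω / 2 := by field_simp
  calc tent x ρ y * f y ≤ (tent x ρ (y + v) + ‖v‖ / ρ) * f y := by
        gcongr
        · exact hf0 y
        · exact tent_sub_le x hρ0 y v
    _ = tent x ρ (y + v) * f y + ‖v‖ / ρ * f y := by ring
    _ ≤ tent x ρ (y + v) * (f (y + v) + ω / 4) + ‖v‖ / ρ * M := by
        gcongr
        · exact tent_nonneg _ _ _
        · exact hfM y
    _ ≤ tent x ρ (y + v) * f (y + v) + 2 * (ω / 4) + ω / 2 := by
        rw [mul_add]
        gcongr
        exact tent_le_two x hρ0 _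
    _ = _ := by ring

/-- A nonnegative continuous function supported in the closed unit ball. -/
structure IsBump (f : E → ℝ) : Prop where
  cont : Continuous f
  nonneg : ∀ y, 0 ≤ f y
  supp : Function.support f ⊆ Metric.closedBall 0 1

lemma IsBump.tsupport_subset {f : E → ℝ} (hf : IsBump f) :
    tsupport f ⊆ Metric.closedBall 0 1 :=
  closure_minimal hf.supp Metric.isClosed_closedBall

variable [InnerProductSpace ℝ E] [FiniteDimensional ℝ E]

lemma IsBump.hasCompactSupport {f : E → ℝ} (hf : IsBump f) : HasCompactSupport f :=
  (isCompact_closedBall (0 : E) 1).of_isClosed_subset (isClosed_tsupport f) hf.tsupport_subset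

lemma IsBump.exists_bound {f : E → ℝ} (hf : IsBump f) : ∃ M > 0, ∀ y, f y ≤ M := by
  obtain ⟨C, hC⟩ := hf.hasCompactSupport.exists_bound_of_continuous hf.cont
  exact ⟨max C 1, by positivity, fun y =>
    (le_abs_self _).trans ((hC y).trans (le_max_left _ _))⟩

variable [MeasurableSpace E] [BorelSpace E]

/-- The integral of a density against a tent function. -/
noncomputable def tentMass (f : E → ℝ) (x : E) (ρ : ℝ) : ℝ≥0∞ :=
  ∫⁻ y, ENNReal.ofReal (tent x ρ y * f y)

/-- The comparison lemma with `F' = F + ω` on the ball of radius 2, which contains all unit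
translates of the support. A second use of it bounds the weighted mass of that ball by the volume of
the ball of radius 3. -/
lemma coordProd_approx {ι : Type*} [Fintype ι] {b : OrthonormalBasis ι ℝ E} {q : ι → ℝ → ℝ} {s : ℝ}
    (hs : 0 < s) (hs1 : Fintype.card ι * s ≤ 1) (hq : ∀ j, IsMeanOne (q j) s) {F : E → ℝ}
    (hFc : Measurable F) (hF1 : Function.support F ⊆ Metric.closedBall 0 1)
    (hF0 : ∀ y, 0 ≤ F y) {ω : ℝ} (hω : 0 ≤ ω)
    (hF : ∀ y v, ‖v‖ ≤ Fintype.card ι * s → F y ≤ F (y + v) + ω) :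
    ∫⁻ y, ENNReal.ofReal (F y * coordProd b q y) ≤
      (∫⁻ y, ENNReal.ofReal (F y)) + ENNReal.ofReal ω * volume (Metric.closedBall (0 : E) 3) ∧
    ∫⁻ y, ENNReal.ofReal (F y) ≤ (∫⁻ y, ENNReal.ofReal (F y * coordProd b q y)) +
      ENNReal.ofReal ω * volume (Metric.closedBall (0 : E) 3) := by
  have hg0 := coordProd_nonneg b (q := q) fun j => (hq j).nonneg
  have hgm : Measurable fun x => ENNReal.ofReal (coordProd b q x) :=
    (continuous_coordProd b fun j => (hq j).cont).measurable.ennreal_ofReal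
  set χ : ℝ → E → ℝ≥0∞ := fun R => (Metric.closedBall (0 : E) R).indicator 1 with hχ
  have hχm : ∀ R, Measurable (χ R) := fun R =>
    measurable_one.indicator Metric.isClosed_closedBall.measurableSet
  have hχχ : ∀ R x v, ‖v‖ ≤ Fintype.card ι * s → χ R x ≤ χ (R + 1) (x + v) := by
    intro R x v hv
    by_cases h1 : x ∈ Metric.closedBall (0 : E) R
    · have h2 : x + v ∈ Metric.closedBall (0 : E) (R + 1) := by
        rw [mem_closedBall_zero_iff] at h1 ⊢
        exact (norm_add_le _ _).trans (add_le_add h1 (hv.trans hs1))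
      simp only [hχ]
      rw [indicator_of_mem h1, indicator_of_mem h2]
      exact le_rfl
    · simp only [hχ]
      rw [indicator_of_notMem h1]
      exact zero_le
  have hχi : ∀ R, ∫⁻ x, χ R x = volume (Metric.closedBall (0 : E) R) := fun R =>
    lintegral_indicator_one Metric.isClosed_closedBall.measurableSet
  set F' : E → ℝ≥0∞ := fun y => ENNReal.ofReal (F y) + ENNReal.ofReal ω * χ 2 y with hF'
  have hF'm : Measurable F' := hFc.ennreal_ofReal.add ((hχm 2).const_mul _)
  have hcmp : ∀ x v, ‖v‖ ≤ Fintype.card ι * s → ENNReal.ofReal (F x) ≤ F' (x + v) := by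
    intro x v hv
    by_cases hx : F x = 0
    · simp [hx]
    have h1 : χ 1 x = 1 := indicator_of_mem (hF1 hx) _
    have h2 : 1 ≤ χ 2 (x + v) := by
      have := hχχ 1 x v hv
      rw [h1] at this
      norm_num at this
      exact this
    calc ENNReal.ofReal (F x) ≤ ENNReal.ofReal (F (x + v) + ω) := ENNReal.ofReal_le_ofReal (hF x v hv)
      _ = ENNReal.ofReal (F (x + v)) + ENNReal.ofReal ω * 1 := by
        rw [ENNReal.ofReal_add (hF0 _) hω, mul_one]
      _ ≤ F' (x + v) := by simp only [hF']; gcongr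
  obtain ⟨h1, h2⟩ := lintegral_coordProd_comparison hs hq (b := b) hFc.ennreal_ofReal hF'm hcmp
  have hχ23 : ∫⁻ y, χ 2 y * ENNReal.ofReal (coordProd b q y) ≤
      volume (Metric.closedBall (0 : E) 3) := by
    have := (lintegral_coordProd_comparison hs hq (b := b) (hχm 2) (hχm (2 + 1)) (hχχ 2)).1
    rw [hχi] at this
    norm_num at this
    exact this
  simp_rw [ENNReal.ofReal_mul (hF0 _)]
  constructor
  · refine h1.trans ?_
    simp only [hF']
    rw [lintegral_add_left hFc.ennreal_ofReal, lintegral_const_mul _ (hχm 2), hχi]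
    gcongr
    norm_num
  · refine h2.trans ?_
    simp only [hF', add_mul]
    have hFg : Measurable fun y => ENNReal.ofReal (F y) * ENNReal.ofReal (coordProd b q y) :=
      hFc.ennreal_ofReal.mul hgm
    rw [lintegral_add_left hFg]
    simp_rw [mul_assoc]
    rw [lintegral_const_mul' _ _ ENNReal.ofReal_ne_top]
    gcongr

/-- The gauge `ρ ^ d * (1 - log ρ)`. -/
noncomputable def logGauge (d ρ : ℝ) : ℝ := ρ ^ d * (1 - Real.log ρ)

lemma tentMass_mul_le {f g : E → ℝ} {M c : ℝ} (hM : 0 ≤ M) (hf0 : ∀ y, 0 ≤ f y)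
    (hfM : ∀ y, f y ≤ M) (hg0 : ∀ y, 0 ≤ g y) (x : E) {ρ : ℝ} (hρ : 0 < ρ)
    (hg : ∫⁻ y in Metric.closedBall x (2 * ρ), ENNReal.ofReal (g y) ≤ ENNReal.ofReal c) :
    tentMass (fun y => f y * g y) x ρ ≤ ENNReal.ofReal (2 * M * c) := by
  rw [ENNReal.ofReal_mul (by positivity : (0 : ℝ) ≤ 2 * M)]
  calc tentMass (fun y => f y * g y) x ρ
      ≤ ∫⁻ y, (Metric.closedBall x (2 * ρ)).indicator
          (fun y => ENNReal.ofReal (2 * M) * ENNReal.ofReal (g y)) y := by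
        refine lintegral_mono fun y => ?_
        by_cases hy : tent x ρ y = 0
        · simp [hy]
        · rw [indicator_of_mem (mem_closedBall_of_tent_ne_zero hρ hy),
            ← ENNReal.ofReal_mul (by positivity)]
          apply ENNReal.ofReal_le_ofReal
          rw [← mul_assoc]
          gcongr
          · exact hg0 y
          · exact hf0 y
          · exact tent_le_two x hρ y
          · exact hfM y
    _ = ENNReal.ofReal (2 * M) * ∫⁻ y in Metric.closedBall x (2 * ρ), ENNReal.ofReal (g y) := by
        rw [lintegral_indicator Metric.isClosed_closedBall.measurableSet,
          lintegral_const_mul' _ _ ENNReal.ofReal_ne_top]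
    _ ≤ _ := by gcongr

variable {m l : ℕ}

/-- The bound is a maximum because each scale is handled in one of two ways: below `ρ₀` by the ball
estimate for the new weight, regardless of the past, and above `ρ₀` by the previous mass plus a
small error. Tents replace indicators of balls so that masses vary continuously under translation.
-/
lemma exists_refinement {b : OrthonormalBasis (Fin m ⊕ Fin l) ℝ E} {W : Submodule ℝ E}
    (hb : IsAdapted b W) {d e κ δ : ℝ} (he : 0 ≤ e) (hκ : 0 < κ) (hm : e + κ ≤ m)
    (hd : d ≤ l + e) (hδ : 0 < δ) {f : E → ℝ} (hf : IsBump f) :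
    ∃ f' : E → ℝ, IsBump f' ∧ tsupport f' ⊆ tsupport f ∧
      HasFineCover (W.starProjection '' tsupport f') δ (e + κ) ∧
      ∫⁻ y, ENNReal.ofReal (f y) ≤ (∫⁻ y, ENNReal.ofReal (f' y)) + ENNReal.ofReal δ ∧
      ∀ x ρ, 0 < ρ → ρ ≤ 1 → tentMass f' x ρ ≤
        max (ENNReal.ofReal (logGauge d ρ)) (tentMass f x ρ + ENNReal.ofReal (δ * ρ ^ d)) := by
  obtain ⟨M, hM, hfM⟩ := hf.exists_bound
  -- The constant of the ball estimate at radius `2 * ρ`, times `2 * M`. For `ρ ≤ exp (-K)` the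
  -- factor `1 - log ρ` exceeds it; the `+ 1` forces `2 * ρ ≤ 1`.
  set K : ℝ := 2 * M * (8 ^ (m + l) * 2 ^ d) + 1 with hK
  have hK1 : 1 ≤ K := by rw [hK]; simp only [le_add_iff_nonneg_left]; positivity
  set ρ₀ : ℝ := Real.exp (-K) with hρ₀
  have hρ₀0 : 0 < ρ₀ := Real.exp_pos _
  have hρ₀2 : ρ₀ ≤ 1 / 2 := by
    calc ρ₀ ≤ Real.exp (-1) := Real.exp_le_exp.2 (by linarith)
      _ ≤ 1 / 2 := by
        rw [Real.exp_neg, one_div]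
        gcongr
        linarith [Real.add_one_le_exp (1 : ℝ)]
  set V : ℝ := (volume (Metric.closedBall (0 : E) 3)).toReal with hV
  have hVt : volume (Metric.closedBall (0 : E) 3) = ENNReal.ofReal V :=
    (ENNReal.ofReal_toReal measure_closedBall_lt_top.ne).symm
  have hV0 : 0 ≤ V := ENNReal.toReal_nonneg
  -- A lower bound for `ρ ^ d` on `[ρ₀, 1]`, whatever the sign of `d`.
  set ρ₁ : ℝ := min 1 (min (ρ₀ ^ d) 1) with hρ₁
  have hρ₁0 : 0 < ρ₁ := by positivity
  set ω : ℝ := δ * ρ₁ / (V + 1) with hω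
  have hω0 : 0 < ω := by positivity
  have hωV : ω * V ≤ δ * ρ₁ := by
    rw [hω, div_mul_eq_mul_div, div_le_iff₀ (by linarith)]
    gcongr
    linarith
  have huc : UniformContinuous f := 
    hf.hasCompactSupport.uniformContinuous_of_continuous hf.cont
  obtain ⟨η, hη, huni⟩ := exists_uniform_tent_mul huc hf.nonneg hM hfM hω0 hρ₀0
  set N : ℝ := m + l + 1 with hN
  have hN1 : 1 ≤ N := by rw [hN]; simp only [le_add_iff_nonneg_left]; positivity
  obtain ⟨r, s, hr, hrs, hsη, hsm, hcov⟩ := exists_scales (m := m) (e := e) (κ := κ)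
    (η := min (min 1 η) δ / N) (K := 2 * (m + l)) he hκ hm (by positivity) (by positivity)
  have hs : 0 < s := hr.trans_le hrs
  rw [le_div_iff₀ (by linarith)] at hsη
  have hNs : (m + l) * s ≤ s * N := by rw [hN]; nlinarith
  have hs1 : s ≤ 1 := by
    calc s ≤ s * N := le_mul_of_one_le_right hs.le hN1
      _ ≤ 1 := hsη.trans ((min_le_left _ _).trans (min_le_left _ _))
  obtain ⟨h, hh, hh4, hhr⟩ := exists_isMeanOne hr hrs
  set q : Fin m ⊕ Fin l → ℝ → ℝ := Sum.elim (fun _ => h) fun _ _ => 1 with hq_def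
  have hq : ∀ j, IsMeanOne (q j) s := by
    rintro (j | j)
    · exact hh
    · exact isMeanOne_one s
  set g : E → ℝ := coordProd b q with hg
  have hg0 : ∀ y, 0 ≤ g y := coordProd_nonneg b fun j => (hq j).nonneg
  have hgc : Continuous g := continuous_coordProd b fun j => (hq j).cont
  have hcard : (Fintype.card (Fin m ⊕ Fin l) : ℝ) = m + l := by simp
  have hcs1 : Fintype.card (Fin m ⊕ Fin l) * s ≤ 1 := by
    rw [hcard]; exact hNs.trans (hsη.trans ((min_le_left _ _).trans (min_le_left _ _)))
  have hcsη : Fintype.card (Fin m ⊕ Fin l) * s ≤ η := by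
    rw [hcard]; exact hNs.trans (hsη.trans ((min_le_left _ _).trans (min_le_right _ _)))
  have hball : ∀ x ρ, 0 < ρ → ρ ≤ 1 → ∫⁻ y in Metric.closedBall x ρ, ENNReal.ofReal (g y) ≤
      ENNReal.ofReal (8 ^ (m + l) * ρ ^ d) := by
    intro x ρ hρ hρ1
    refine (setLIntegral_closedBall_coordProd_le (fun j => (hq j).cont) (fun j => (hq j).nonneg) x
      hρ.le).trans ?_
    set A := min (8 * ρ * s / r) (2 * ρ + s) with hA
    have hA0 : 0 ≤ A := by positivity
    have hl : ∀ j : Fin m, ∫ u in (b.repr x (Sum.inl j) - ρ)..(b.repr x (Sum.inl j) + ρ),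
        q (Sum.inl j) u ≤ A := by
      intro j
      set a := b.repr x (Sum.inl j)
      refine le_min ?_ ?_
      · calc ∫ u in (a - ρ)..(a + ρ), q (Sum.inl j) u ≤ ∫ u in (a - ρ)..(a + ρ), 4 * s / r :=
              intervalIntegral.integral_mono_on (by linarith) (hh.cont.intervalIntegrable _ _)
                (by simp) fun u _ => hh4 u
          _ = 8 * ρ * s / r := by
              rw [intervalIntegral.integral_const, smul_eq_mul]; ring
      · have := hh.integral_le hs (a - ρ) (t := 2 * ρ) (by linarith)
        rwa [show a - ρ + 2 * ρ = a + ρ by ring] at this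
    rw [Fintype.prod_sum_type]
    have hr' : ∀ j : Fin l, ∫ u in (b.repr x (Sum.inr j) - ρ)..(b.repr x (Sum.inr j) + ρ),
        q (Sum.inr j) u = 2 * ρ := by
      intro j
      simp only [hq_def, Sum.elim_inr, intervalIntegral.integral_const, smul_eq_mul]
      ring
    simp_rw [hr']
    calc _ ≤ (∏ _j : Fin m, ENNReal.ofReal A) * ∏ _j : Fin l, ENNReal.ofReal (2 * ρ) := by
          gcongr with j
          exact hl j
      _ = ENNReal.ofReal (A ^ m * (2 * ρ) ^ l) := by
          rw [ENNReal.ofReal_mul (p := A ^ m) (by positivity), ENNReal.ofReal_pow hA0,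
            ENNReal.ofReal_pow (by positivity), Finset.prod_const, Finset.prod_const]
          simp
      _ ≤ _ := ENNReal.ofReal_le_ofReal (pow_mul_pow_le_rpow hr hrs he (by linarith) hd hsm hρ hρ1
          hA0 (min_le_left _ _) (min_le_right _ _))
  have htsub : tsupport (fun y => f y * g y) ⊆ tsupport f := by
    exact closure_mono (Function.support_mul_subset_left f g)
  refine ⟨fun y => f y * g y, ⟨hf.cont.mul hgc, fun y => mul_nonneg (hf.nonneg y) (hg0 y),
    (Function.support_mul_subset_left f g).trans hf.supp⟩, htsub, ?_, ?_, ?_⟩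
  · refine hb.hasFineCover hr hrs hs1 ?_ hcov (htsub.trans hf.tsupport_subset) ?_
    · calc ((m : ℝ) + l) * r ≤ (m + l) * s := by gcongr
        _ ≤ δ := hNs.trans (hsη.trans (min_le_right _ _))
    · intro x hx j
      have hcl : IsClosed {x : E | ‖(b.repr x (Sum.inl j) : AddCircle s)‖ ≤ r} := by
        refine isClosed_le ?_ continuous_const
        refine ((AddCircle.continuous_mk' s).comp ?_).norm
        simp only [b.repr_apply_apply]
        fun_prop
      refine closure_minimal ?_ hcl hx
      intro y hy
      refine hhr _ fun h0 => hy ?_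
      simp only [hg, coordProd]
      rw [Finset.prod_eq_zero (Finset.mem_univ (Sum.inl j)) h0, mul_zero]
  · refine ((coordProd_approx hs hcs1 hq (b := b) hf.cont.measurable hf.supp hf.nonneg hω0.le
      fun y v hv => (huni y v (hv.trans hcsη)).1).2).trans ?_
    gcongr
    rw [hVt, ← ENNReal.ofReal_mul hω0.le]
    apply ENNReal.ofReal_le_ofReal
    refine hωV.trans (mul_le_of_le_one_right hδ.le (min_le_left _ _))
  · intro x ρ hρ hρ1
    rcases le_total ρ ρ₀ with h1 | h1
    · refine le_max_of_le_left ?_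
      refine (tentMass_mul_le hM.le hf.nonneg hfM hg0 x hρ
        (hball x (2 * ρ) (by linarith) (by linarith))).trans ?_
      apply ENNReal.ofReal_le_ofReal
      rw [logGauge, Real.mul_rpow zero_le_two hρ.le]
      have h2 : Real.log ρ ≤ -K := by
        rw [← Real.log_exp (-K)]
        exact Real.log_le_log hρ h1
      calc 2 * M * (8 ^ (m + l) * (2 ^ d * ρ ^ d)) = ρ ^ d * (2 * M * (8 ^ (m + l) * 2 ^ d)) := by ring
        _ ≤ ρ ^ d * (1 - Real.log ρ) := by
          gcongr
          linarith
    · refine le_max_of_le_right ?_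
      have h2 := (coordProd_approx hs hcs1 hq (b := b) (F := fun y => tent x ρ y * f y)
        ((continuous_tent x ρ).mul hf.cont).measurable
        ((Function.support_mul_subset_right _ f).trans hf.supp)
        (fun y => mul_nonneg (tent_nonneg _ _ _) (hf.nonneg y)) hω0.le
        fun y v hv => (huni y v (hv.trans hcsη)).2 x ρ h1).1
      simp_rw [mul_assoc] at h2
      refine h2.trans ?_
      unfold tentMass
      gcongr
      rw [hVt, ← ENNReal.ofReal_mul hω0.le]
      apply ENNReal.ofReal_le_ofReal
      refine hωV.trans ?_
      gcongr
      rcases le_total 0 d with h3 | h3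
      · exact ((min_le_right _ _).trans (min_le_left _ _)).trans (Real.rpow_le_rpow hρ₀0.le h1 h3)
      · exact (min_le_left _ _).trans (Real.one_le_rpow_of_pos_of_le_one_of_nonpos hρ hρ1 h3)

end Step

/-! ### Dimension bounds from covers and from masses. -/

lemma HasFineCover.mono {X : Type*} [PseudoMetricSpace X] {A B : Set X} {δ δ' τ τ' : ℝ}
    (h : HasFineCover A δ τ) (hBA : B ⊆ A) (hδ : δ ≤ δ') (hδ1 : 2 * δ ≤ 1) (hτ0 : 0 ≤ τ)
    (hτ : τ ≤ τ') : HasFineCover B δ' τ' := by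
  obtain ⟨c, R, hR, hRδ, hA, hc⟩ := h
  refine ⟨c, R, hR, hRδ.trans hδ, hBA.trans hA, le_trans ?_ hc⟩
  gcongr ?_ * ?_
  exact Real.rpow_le_rpow_of_exponent_ge' (by linarith) (by linarith) hτ0 hτ

lemma dimH_le_of_hasFineCover {X : Type*} [MetricSpace X] {A : Set X} {e : ℝ} (he : 0 ≤ e)
    (h : ∀ δ > 0, ∀ τ > e, HasFineCover A δ τ) : dimH A ≤ ENNReal.ofReal e := by
  borelize X
  refine le_of_forall_gt_imp_ge_of_dense fun a ha => ?_
  obtain ⟨t, ht1, ht2⟩ := ENNReal.lt_iff_exists_nnreal_btwn.1 ha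
  refine le_trans (dimH_le_of_hausdorffMeasure_ne_top ?_) ht2.le
  have het : e < t := by
    rwa [← ENNReal.ofReal_coe_nnreal, ENNReal.ofReal_lt_ofReal_iff_of_nonneg he] at ht1
  choose c R hR0 hRδ hcov hsum using fun p : ℕ => h (1 / ((p : ℝ) + 1)) (by positivity) t het
  have hdiam : ∀ p (y : X), Metric.ediam (Metric.closedBall y (R p)) ≤ ENNReal.ofReal (2 * R p) := by
    intro p y
    refine Metric.ediam_le fun a ha b hb => ?_
    rw [edist_dist]
    apply ENNReal.ofReal_le_ofReal
    calc dist a b ≤ dist a y + dist b y := dist_triangle_right a b y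
      _ ≤ 2 * R p := by rw [two_mul]; exact add_le_add ha hb
  have hle : μH[t] A ≤ Filter.liminf (fun p => ∑ i : c p,
      Metric.ediam (Metric.closedBall (i : X) (R p)) ^ (t : ℝ)) Filter.atTop := by
    refine Measure.hausdorffMeasure_le_liminf_sum (t : ℝ) A
      (fun p : ℕ => ENNReal.ofReal (2 * (1 / ((p : ℝ) + 1)))) ?_
      (fun p (i : c p) => Metric.closedBall (i : X) (R p)) ?_ ?_
    · rw [← ENNReal.ofReal_zero]
      apply ENNReal.tendsto_ofReal
      simpa using tendsto_one_div_add_atTop_nhds_zero_nat.const_mul (2 : ℝ)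
    · refine Filter.Eventually.of_forall fun p i => (hdiam p i).trans ?_
      apply ENNReal.ofReal_le_ofReal
      linarith [hRδ p]
    · refine Filter.Eventually.of_forall fun p => (hcov p).trans ?_
      rw [iUnion_subtype]
  have hone : Filter.liminf (fun p => ∑ i : c p,
      Metric.ediam (Metric.closedBall (i : X) (R p)) ^ (t : ℝ)) Filter.atTop ≤ 1 := by
    refine Filter.liminf_le_of_le (by isBoundedDefault) fun b hb => ?_
    obtain ⟨p, hp⟩ := hb.exists
    refine hp.trans ?_
    calc ∑ i : c p, Metric.ediam (Metric.closedBall (i : X) (R p)) ^ (t : ℝ)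
        ≤ ∑ _i : c p, ENNReal.ofReal (2 * R p) ^ (t : ℝ) := by
          gcongr with i
          exact hdiam p i
      _ = ENNReal.ofReal ((c p).card * (2 * R p) ^ (t : ℝ)) := by
          rw [ENNReal.ofReal_mul (p := ((c p).card : ℝ)) (by positivity),
            ENNReal.ofReal_rpow_of_nonneg (by linarith [hR0 p]) t.coe_nonneg]
          simp only [Finset.sum_const, Finset.card_univ, Fintype.card_coe, nsmul_eq_mul,
            ENNReal.ofReal_natCast]
      _ ≤ 1 := by
          rw [ENNReal.ofReal_le_one]
          exact hsum p
  exact ((hle.trans hone).trans_lt ENNReal.one_lt_top).ne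

/-- A mass distribution principle for the image of a decreasing intersection of compact sets. -/
lemma hausdorffMeasure_image_iInter_ne_zero {X Y : Type*} [TopologicalSpace X] [T2Space X]
    [MeasurableSpace X] [MetricSpace Y] [MeasurableSpace Y] [BorelSpace Y] {C : ℕ → Set X}
    (hC : ∀ k, IsCompact (C k)) (hanti : Antitone C) {P : X → Y} (hP : Continuous P)
    {ν : ℕ → Measure X} {c₀ K : ℝ≥0∞} (hc₀ : c₀ ≠ 0) (hK : K ≠ ∞) (hν : ∀ k, c₀ ≤ ν k (C k))
    {t ρ₀ : ℝ} (ht : 0 < t) (hρ₀ : 0 < ρ₀)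
    (hball : ∀ k y ρ, 0 < ρ → ρ ≤ ρ₀ →
      ν k (P ⁻¹' Metric.closedBall y ρ) ≤ K * ENNReal.ofReal ρ ^ t) :
    μH[t] (P '' ⋂ k, C k) ≠ 0 := by
  intro h0
  -- One `ε` pays for the cover, the other for enlarging its members to open sets.
  obtain ⟨ε, hε, hεK⟩ := ENNReal.exists_nnreal_pos_mul_lt (a := 2 * K)
    (ENNReal.mul_ne_top ENNReal.ofNat_ne_top hK) hc₀
  have hε0 : (ε : ℝ≥0∞) ≠ 0 := by exact_mod_cast hε.ne'
  rw [Measure.hausdorffMeasure_apply] at h0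
  have h1 := le_antisymm (le_trans (le_iSup₂ (f := fun (r : ℝ≥0∞) (_ : 0 < r) =>
    ⨅ (t_1 : ℕ → Set Y) (_ : P '' ⋂ k, C k ⊆ ⋃ n, t_1 n) (_ : ∀ n, Metric.ediam (t_1 n) ≤ r),
      ∑' n, ⨆ _ : (t_1 n).Nonempty, Metric.ediam (t_1 n) ^ t) (ENNReal.ofReal (ρ₀ / 2))
      (ENNReal.ofReal_pos.2 (by linarith))) h0.le) (zero_le)
  have h2 := h1.trans_lt (pos_iff_ne_zero.2 hε0)
  simp only [iInf_lt_iff] at h2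
  obtain ⟨U, hU, hUd, hUs⟩ := h2
  obtain ⟨ε', hε'0, hε's⟩ := ENNReal.exists_pos_sum_of_countable' hε0 ℕ
  -- Each nonempty member is replaced by a ball of radius slightly above its diameter, which also
  -- makes the radius positive when the diameter is zero.
  have hO : ∀ j, ∃ O : Set Y, IsOpen O ∧ U j ⊆ O ∧
      ∀ k, ν k (P ⁻¹' O) ≤ K * ((⨆ _ : (U j).Nonempty, Metric.ediam (U j) ^ t) + ε' j) := by
    intro j
    rcases (U j).eq_empty_or_nonempty with he | hne
    · exact ⟨∅, isOpen_empty, he.le, fun k => by simp⟩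
    obtain ⟨y, hy⟩ := hne
    set D := Metric.ediam (U j) with hD
    have hDρ : D < ENNReal.ofReal ρ₀ :=
      (hUd j).trans_lt ((ENNReal.ofReal_lt_ofReal_iff hρ₀).2 (by linarith))
    have hDt : D ^ t < D ^ t + ε' j :=
      ENNReal.lt_add_right (ENNReal.rpow_ne_top_of_nonneg ht.le hDρ.ne_top) (hε'0 j).ne'
    have hcont : ∀ᶠ x in nhds D, x ^ t < D ^ t + ε' j :=
      (ENNReal.continuous_rpow_const (y := t)).continuousAt.eventually_lt continuousAt_const hDt
    have hlt : ∀ᶠ x in nhds D, x < ENNReal.ofReal ρ₀ := eventually_lt_nhds hDρ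
    have : (nhdsWithin D (Ioi D)).NeBot := nhdsGT_neBot_of_exists_gt ⟨_, hDρ⟩
    obtain ⟨x, ⟨hx1, hx2⟩, hx3⟩ :=
      (((hcont.and hlt).filter_mono nhdsWithin_le_nhds).and
        (eventually_mem_nhdsWithin (a := D) (s := Ioi D))).exists
    have hx3 : D < x := hx3
    have hxt : x ≠ ∞ := hx2.ne_top
    have hx0 : 0 < x.toReal := ENNReal.toReal_pos (zero_le.trans_lt hx3).ne' hxt
    refine ⟨Metric.ball y x.toReal, Metric.isOpen_ball, fun z hz => ?_, fun k => ?_⟩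
    · rw [Metric.mem_ball, ← ENNReal.ofReal_lt_ofReal_iff hx0, ← edist_dist,
        ENNReal.ofReal_toReal hxt]
      exact (Metric.edist_le_ediam_of_mem hz hy).trans_lt hx3
    · calc ν k (P ⁻¹' Metric.ball y x.toReal)
          ≤ ν k (P ⁻¹' Metric.closedBall y x.toReal) :=
            measure_mono (preimage_mono Metric.ball_subset_closedBall)
        _ ≤ K * x ^ t := by
            have := hball k y x.toReal hx0
              (by simpa [ENNReal.toReal_ofReal hρ₀.le] using
                ENNReal.toReal_mono ENNReal.ofReal_ne_top hx2.le)
            rwa [ENNReal.ofReal_toReal hxt] at this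
        _ ≤ _ := by
            gcongr
            rw [ciSup_pos ⟨y, hy⟩]
            exact hx1.le
  choose O hOo hUO hOν using hO
  have hopen : IsOpen (⋃ j, P ⁻¹' O j) := isOpen_iUnion fun j => (hOo j).preimage hP
  have hsub : ⋂ k, C k ⊆ ⋃ j, P ⁻¹' O j := by
    intro x hx
    obtain ⟨j, hj⟩ := mem_iUnion.1 (hU (mem_image_of_mem P hx))
    exact mem_iUnion.2 ⟨j, hUO j hj⟩
  -- Compactness stands in for a limit measure: the open cover of the intersection already covers
  -- some `C k`, and `ν k` gives the contradiction.
  obtain ⟨k, hk⟩ := exists_subset_nhds_of_isCompact hanti.directed_ge hC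
    (fun x hx => hopen.mem_nhds (hsub hx))
  refine absurd (hν k) (not_le.2 ?_)
  calc ν k (C k) ≤ ν k (⋃ j, P ⁻¹' O j) := measure_mono hk
    _ ≤ ∑' j, ν k (P ⁻¹' O j) := measure_iUnion_le _
    _ ≤ ∑' j, K * ((⨆ _ : (U j).Nonempty, Metric.ediam (U j) ^ t) + ε' j) :=
        ENNReal.tsum_le_tsum fun j => hOν j k
    _ = K * ((∑' j, ⨆ _ : (U j).Nonempty, Metric.ediam (U j) ^ t) + ∑' j, ε' j) := by
        rw [ENNReal.tsum_mul_left, ENNReal.tsum_add]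
    _ ≤ K * (ε + ε) := by gcongr
    _ = ε * (2 * K) := by ring
    _ < c₀ := hεK

lemma rpow_le_logGauge {d ρ : ℝ} (hρ : 0 < ρ) (hρ1 : ρ ≤ 1) : ρ ^ d ≤ logGauge d ρ := by
  refine le_mul_of_one_le_right (by positivity) ?_
  linarith [Real.log_nonpos hρ.le hρ1]

lemma logGauge_le {d t ρ : ℝ} (ht : t < d) (hρ : 0 < ρ) (hρ1 : ρ ≤ 1) :
    logGauge d ρ ≤ (1 + 1 / (d - t)) * ρ ^ t := by
  have hε : 0 < d - t := by linarith
  have h1 : -Real.log ρ ≤ ρ ^ (-(d - t)) / (d - t) := by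
    have := Real.log_le_rpow_div (inv_nonneg.2 hρ.le) hε
    rwa [Real.log_inv, Real.inv_rpow hρ.le, ← Real.rpow_neg hρ.le] at this
  have h2 : 1 ≤ ρ ^ (-(d - t)) :=
    Real.one_le_rpow_of_pos_of_le_one_of_nonpos hρ hρ1 (by linarith)
  calc logGauge d ρ ≤ ρ ^ d * (ρ ^ (-(d - t)) + ρ ^ (-(d - t)) / (d - t)) := by
        unfold logGauge
        gcongr
        linarith
    _ = (1 + 1 / (d - t)) * (ρ ^ d * ρ ^ (-(d - t))) := by ring
    _ = (1 + 1 / (d - t)) * ρ ^ t := by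
        rw [← Real.rpow_add hρ]; ring_nf

/-! ### The sequence of densities and its limit set. -/

section Construction

variable {E : Type*} [NormedAddCommGroup E] [InnerProductSpace ℝ E] [FiniteDimensional ℝ E]
  [MeasurableSpace E] [BorelSpace E]

/-- The dimension forced on the projection to `W` of a set of dimension `d`. -/
noncomputable def projDim (W : Submodule ℝ E) (d : ℝ) : ℝ :=
  max 0 (d - Module.finrank ℝ (E ⧸ W))

omit [FiniteDimensional ℝ E] [MeasurableSpace E] [BorelSpace E] in
lemma projDim_nonneg (W : Submodule ℝ E) (d : ℝ) : 0 ≤ projDim W d := le_max_left _ _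

omit [FiniteDimensional ℝ E] [MeasurableSpace E] [BorelSpace E] in
lemma sub_finrank_le_projDim (W : Submodule ℝ E) (d : ℝ) :
    d - Module.finrank ℝ (E ⧸ W) ≤ projDim W d := le_max_right _ _

omit [MeasurableSpace E] [BorelSpace E] in
-- This strict gap is the room for `κ` in the refinement step; it is the reason for treating `d = n`
-- and `W = ⊥` separately.
lemma projDim_lt {W : Submodule ℝ E} (hW : W ≠ ⊥) {d : ℝ} (hd : d < Module.finrank ℝ E) :
    projDim W d < Module.finrank ℝ W := by
  have h1 : 0 < Module.finrank ℝ W := by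
    rwa [Nat.pos_iff_ne_zero, ne_eq, Submodule.finrank_eq_zero]
  have h2 : (Module.finrank ℝ (E ⧸ W) : ℝ) + Module.finrank ℝ W = Module.finrank ℝ E := by
    exact_mod_cast W.finrank_quotient_add_finrank
  exact max_lt (by exact_mod_cast h1) (by linarith)

lemma exists_refinement_submodule {W : Submodule ℝ E} (hW : W ≠ ⊥) {d δ : ℝ}
    (hd : d < Module.finrank ℝ E) (hδ : 0 < δ) (hδ1 : 2 * δ ≤ 1) {f : E → ℝ} (hf : IsBump f) :
    ∃ f' : E → ℝ, IsBump f' ∧ tsupport f' ⊆ tsupport f ∧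
      HasFineCover (W.starProjection '' tsupport f') δ (projDim W d + δ) ∧
      ∫⁻ y, ENNReal.ofReal (f y) ≤ (∫⁻ y, ENNReal.ofReal (f' y)) + ENNReal.ofReal δ ∧
      ∀ x ρ, 0 < ρ → ρ ≤ 1 → tentMass f' x ρ ≤
        max (ENNReal.ofReal (logGauge d ρ)) (tentMass f x ρ + ENNReal.ofReal (δ * ρ ^ d)) := by
  obtain ⟨b, hb⟩ := exists_isAdapted W rfl rfl
  have he := projDim_lt hW hd
  have he0 := projDim_nonneg W d
  obtain ⟨f', h1, h2, h3, h4, h5⟩ := exists_refinement hb (d := d) (e := projDim W d)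
    (κ := min δ (Module.finrank ℝ W - projDim W d)) (δ := δ) he0 (lt_min hδ (by linarith))
    (by linarith [min_le_right δ (Module.finrank ℝ W - projDim W d)])
    (by linarith [sub_finrank_le_projDim W d]) hδ hf
  refine ⟨f', h1, h2, h3.mono le_rfl le_rfl hδ1 ?_ ?_, h4, h5⟩
  · have : 0 ≤ min δ (Module.finrank ℝ W - projDim W d) := le_min hδ.le (by linarith)
    linarith
  · linarith [min_le_left δ (Module.finrank ℝ W - projDim W d)]

lemma exists_bump_tentMass_le {d : ℝ} (hd : d ≤ Module.finrank ℝ E) :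
    ∃ f : E → ℝ, IsBump f ∧ (∫⁻ y, ENNReal.ofReal (f y)) ≠ 0 ∧ ∃ A : ℝ, 1 ≤ A ∧
      ∀ x ρ, 0 < ρ → ρ ≤ 1 → tentMass f x ρ ≤ ENNReal.ofReal (A * logGauge d ρ) := by
  set f : E → ℝ := fun y => max 0 (1 - ‖y‖) with hf
  have hfc : Continuous f := by fun_prop
  have hf0 : ∀ y, 0 ≤ f y := fun y => le_max_left _ _
  have hf1 : ∀ y, f y ≤ 1 := fun y => max_le zero_le_one (by linarith [norm_nonneg y])
  set v : ℝ := (volume (Metric.closedBall (0 : E) 1)).toReal with hv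
  have hvt : volume (Metric.closedBall (0 : E) 1) = ENNReal.ofReal v :=
    (ENNReal.ofReal_toReal measure_closedBall_lt_top.ne).symm
  have hv0 : 0 ≤ v := ENNReal.toReal_nonneg
  refine ⟨f, ⟨hfc, hf0, fun y hy => ?_⟩, ?_, 2 * (2 ^ Module.finrank ℝ E * v) + 1, ?_, ?_⟩
  · by_contra hc
    rw [mem_closedBall_zero_iff, not_le] at hc
    exact hy (max_eq_left (by linarith))
  · have hcc : Continuous fun y => ENNReal.ofReal (f y) := ENNReal.continuous_ofReal.comp hfc
    rw [ne_eq, lintegral_eq_zero_iff hcc.measurable]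
    intro h
    have := congrFun ((Continuous.ae_eq_iff_eq volume hcc continuous_const).1 h) (0 : E)
    simp [hf] at this
  · have : 0 ≤ 2 * (2 ^ Module.finrank ℝ E * v) := by positivity
    linarith
  · intro x ρ hρ hρ1
    have := tentMass_mul_le (f := f) (g := fun _ => 1) (M := 1)
      (c := (2 * ρ) ^ Module.finrank ℝ E * v) zero_le_one hf0 hf1 (fun _ => zero_le_one) x hρ (by
        rw [ENNReal.ofReal_one, setLIntegral_const, one_mul,
          Measure.addHaar_closedBall' _ _ (by positivity), hvt, ENNReal.ofReal_mul (by positivity)])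
    simp only [mul_one] at this
    refine this.trans (ENNReal.ofReal_le_ofReal ?_)
    have h1 : ρ ^ Module.finrank ℝ E ≤ logGauge d ρ := by
      refine le_trans ?_ (rpow_le_logGauge hρ hρ1)
      rw [← Real.rpow_natCast]
      exact Real.rpow_le_rpow_of_exponent_ge hρ hρ1 hd
    have h2 : 0 ≤ logGauge d ρ := le_trans (by positivity) h1
    calc 2 * ((2 * ρ) ^ Module.finrank ℝ E * v)
        = 2 * (2 ^ Module.finrank ℝ E * v) * ρ ^ Module.finrank ℝ E := by rw [mul_pow]; ring
      _ ≤ 2 * (2 ^ Module.finrank ℝ E * v) * logGauge d ρ := by gcongr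
      _ ≤ _ := by gcongr; linarith

/-- Step `k` is allowed the error `δ * (1 / 2) ^ (k + 1)`. These errors total at most `δ`, which is
less than the initial mass, so mass at least `c₀ > 0` survives and the gauge constant grows at most
from `A` to `A + δ`. -/
lemma exists_bump_sequence {d : ℝ} (hd : d < Module.finrank ℝ E) (V : ℕ → Submodule ℝ E)
    (hV : ∀ k, V k ≠ ⊥) : ∃ (f : ℕ → E → ℝ) (c₀ : ℝ≥0∞) (A : ℝ), c₀ ≠ 0 ∧ 0 ≤ A ∧ ∀ k,
      IsBump (f k) ∧ tsupport (f (k + 1)) ⊆ tsupport (f k) ∧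
      HasFineCover ((V k).starProjection '' tsupport (f (k + 1))) ((1 / 2) ^ (k + 1))
        (projDim (V k) d + (1 / 2) ^ (k + 1)) ∧
      c₀ ≤ ∫⁻ y, ENNReal.ofReal (f k y) ∧
      ∀ x ρ, 0 < ρ → ρ ≤ 1 → tentMass (f k) x ρ ≤ ENNReal.ofReal (A * logGauge d ρ) := by
  obtain ⟨f₀, hf₀, hI, A, hA, hfA⟩ := exists_bump_tentMass_le (E := E) hd.le
  obtain ⟨c, hc0, hcI⟩ := ENNReal.lt_iff_exists_nnreal_btwn.1 (pos_iff_ne_zero.2 hI)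
  set δ : ℝ := min c 1 with hδ
  have hδ0 : 0 < δ := lt_min (by exact_mod_cast hc0) one_pos
  have hδ1 : δ ≤ 1 := min_le_right _ _
  have hδc : ENNReal.ofReal δ < ∫⁻ y, ENNReal.ofReal (f₀ y) := by
    refine lt_of_le_of_lt ?_ hcI
    rw [← ENNReal.ofReal_coe_nnreal]
    exact ENNReal.ofReal_le_ofReal (min_le_left _ _)
  have hpow : ∀ k : ℕ, (1 / 2 : ℝ) ^ (k + 1) ≤ 1 / 2 := fun k =>
    pow_le_of_le_one (by norm_num) (by norm_num) k.succ_ne_zero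
  have hδk : ∀ k : ℕ, δ * (1 / 2) ^ (k + 1) ≤ (1 / 2) ^ (k + 1) := fun k =>
    mul_le_of_le_one_left (by positivity) hδ1
  have hstep : ∀ (k : ℕ) (f : {f : E → ℝ // IsBump f}), ∃ f' : {f : E → ℝ // IsBump f},
      tsupport f'.1 ⊆ tsupport f.1 ∧
      HasFineCover ((V k).starProjection '' tsupport f'.1) (δ * (1 / 2) ^ (k + 1))
        (projDim (V k) d + δ * (1 / 2) ^ (k + 1)) ∧
      ∫⁻ y, ENNReal.ofReal (f.1 y) ≤
        (∫⁻ y, ENNReal.ofReal (f'.1 y)) + ENNReal.ofReal (δ * (1 / 2) ^ (k + 1)) ∧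
      ∀ x ρ, 0 < ρ → ρ ≤ 1 → tentMass f'.1 x ρ ≤ max (ENNReal.ofReal (logGauge d ρ))
        (tentMass f.1 x ρ + ENNReal.ofReal (δ * (1 / 2) ^ (k + 1) * ρ ^ d)) := by
    intro k f
    obtain ⟨f', h1, h2⟩ := exists_refinement_submodule (hV k) (δ := δ * (1 / 2) ^ (k + 1)) hd
      (by positivity) (by linarith [hpow k, hδk k]) f.2
    exact ⟨⟨f', h1⟩, h2⟩
  choose Φ hΦ1 hΦ2 hΦ3 hΦ4 using hstep
  set f : ℕ → {f : E → ℝ // IsBump f} := fun k => Nat.rec ⟨f₀, hf₀⟩ Φ k with hf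
  have hfs : ∀ k, f (k + 1) = Φ k (f k) := fun k => rfl
  have hint : ∀ k, ∫⁻ y, ENNReal.ofReal (f₀ y) ≤
      (∫⁻ y, ENNReal.ofReal ((f k).1 y)) + ENNReal.ofReal (δ * (1 - (1 / 2) ^ k)) := by
    intro k
    induction k with
    | zero => simp [hf]
    | succ k ih =>
      refine ih.trans ((add_le_add_left (hΦ3 k (f k)) _).trans ?_)
      rw [add_assoc, ← ENNReal.ofReal_add (by positivity)
        (mul_nonneg hδ0.le (sub_nonneg.2 (pow_le_one₀ (by norm_num) (by norm_num)))), ← hfs]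
      gcongr
      apply le_of_eq
      rw [pow_succ]; ring
  have hmass : ∀ k x ρ, 0 < ρ → ρ ≤ 1 →
      tentMass (f k).1 x ρ ≤ ENNReal.ofReal ((A + δ * (1 - (1 / 2) ^ k)) * logGauge d ρ) := by
    intro k
    induction k with
    | zero => simpa [hf] using hfA
    | succ k ih =>
      intro x ρ hρ hρ1
      have hg := rpow_le_logGauge (d := d) hρ hρ1
      have hρd : 0 < ρ ^ d := by positivity
      have hp : (1 / 2 : ℝ) ^ k ≤ 1 := pow_le_one₀ (by norm_num) (by norm_num)
      have hp' : (1 / 2 : ℝ) ^ (k + 1) ≤ 1 := pow_le_one₀ (by norm_num) (by norm_num)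
      rw [hfs]
      refine (hΦ4 k (f k) x ρ hρ hρ1).trans (max_le ?_ ?_)
      · apply ENNReal.ofReal_le_ofReal
        refine le_mul_of_one_le_left (by linarith) ?_
        have : 0 ≤ δ * (1 - (1 / 2) ^ (k + 1)) := mul_nonneg hδ0.le (by linarith)
        linarith
      · refine (add_le_add_left (ih x ρ hρ hρ1) _).trans ?_
        have : 0 ≤ δ * (1 - (1 / 2) ^ k) := mul_nonneg hδ0.le (by linarith)
        rw [← ENNReal.ofReal_add (mul_nonneg (by linarith) (by linarith)) (by positivity)]
        apply ENNReal.ofReal_le_ofReal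
        calc (A + δ * (1 - (1 / 2) ^ k)) * logGauge d ρ + δ * (1 / 2) ^ (k + 1) * ρ ^ d
            ≤ (A + δ * (1 - (1 / 2) ^ k)) * logGauge d ρ +
                δ * (1 / 2) ^ (k + 1) * logGauge d ρ := by gcongr
          _ = _ := by rw [pow_succ]; ring
  refine ⟨fun k => (f k).1, (∫⁻ y, ENNReal.ofReal (f₀ y)) - ENNReal.ofReal δ, A + δ,
    (tsub_pos_of_lt hδc).ne', by linarith, fun k => ⟨(f k).2, hΦ1 k (f k), ?_, ?_, ?_⟩⟩
  · exact (hΦ2 k (f k)).mono le_rfl (hδk k) (by linarith [hpow k, hδk k])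
      (add_nonneg (projDim_nonneg _ _) (by positivity)) (by linarith [hδk k])
  · rw [tsub_le_iff_right]
    refine (hint k).trans ?_
    gcongr
    exact mul_le_of_le_one_right hδ0.le (by simp)
  · intro x ρ hρ hρ1
    refine (hmass k x ρ hρ hρ1).trans (ENNReal.ofReal_le_ofReal ?_)
    have : 0 ≤ logGauge d ρ := le_trans (by positivity) (rpow_le_logGauge hρ hρ1)
    gcongr
    exact mul_le_of_le_one_right hδ0.le (by simp)

lemma setLIntegral_tube_le {d A : ℝ} {f : E → ℝ} (hf : IsBump f)
    (hA : ∀ x ρ, 0 < ρ → ρ ≤ 1 → tentMass f x ρ ≤ ENNReal.ofReal (A * logGauge d ρ))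
    (hE : 0 < Module.finrank ℝ E) (W : Submodule ℝ E) (y : E) {ρ : ℝ} (hρ : 0 < ρ)
    (hρ1 : Module.finrank ℝ E * ρ ≤ 1) :
    ∫⁻ x in W.starProjection ⁻¹' Metric.closedBall y ρ, ENNReal.ofReal (f x) ≤
      ENNReal.ofReal ((5 / ρ) ^ Module.finrank ℝ (E ⧸ W)) *
        ENNReal.ofReal (A * logGauge d (Module.finrank ℝ E * ρ)) := by
  obtain ⟨b, hb⟩ := exists_isAdapted W rfl rfl
  have hE1 : (1 : ℝ) ≤ Module.finrank ℝ E := by exact_mod_cast hE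
  have hsum : (Module.finrank ℝ W : ℝ) + Module.finrank ℝ (E ⧸ W) = Module.finrank ℝ E := by
    rw [add_comm]; exact_mod_cast W.finrank_quotient_add_finrank
  obtain ⟨c, hc, hcov⟩ := hb.exists_tube_cover hρ
    ((le_mul_of_one_le_left hρ.le hE1).trans hρ1) y
  rw [hsum] at hcov
  set N : ℝ := (Module.finrank ℝ E : ℝ)
  have hNρ : 0 < N * ρ := by positivity
  set T := W.starProjection ⁻¹' Metric.closedBall y ρ
  have hTm : MeasurableSet T :=
    (Metric.isClosed_closedBall.preimage W.starProjection.continuous).measurableSet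
  have hball : ∀ z, ∫⁻ x in Metric.closedBall z (N * ρ), ENNReal.ofReal (f x) ≤
      ENNReal.ofReal (A * logGauge d (N * ρ)) := by
    intro z
    refine le_trans ?_ (hA z (N * ρ) hNρ hρ1)
    rw [← lintegral_indicator Metric.isClosed_closedBall.measurableSet]
    refine lintegral_mono fun x => ?_
    by_cases hx : x ∈ Metric.closedBall z (N * ρ)
    · rw [indicator_of_mem hx]
      exact ENNReal.ofReal_le_ofReal
        (le_mul_of_one_le_left (hf.nonneg x) (one_le_tent hNρ hx))
    · rw [indicator_of_notMem hx]
      exact zero_le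
  calc ∫⁻ x in T, ENNReal.ofReal (f x)
      = ∫⁻ x in T, (Metric.closedBall (0 : E) 1).indicator (fun x => ENNReal.ofReal (f x)) x := by
        refine lintegral_congr fun x => ?_
        by_cases hx : x ∈ Metric.closedBall (0 : E) 1
        · rw [indicator_of_mem hx]
        · rw [indicator_of_notMem hx, ENNReal.ofReal_eq_zero]
          exact (by_contra fun h0 => hx (hf.supp fun h1 => h0 h1.le))
    _ = ∫⁻ x in Metric.closedBall 0 1 ∩ T, ENNReal.ofReal (f x) := by
        rw [lintegral_indicator Metric.isClosed_closedBall.measurableSet,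
          Measure.restrict_restrict Metric.isClosed_closedBall.measurableSet]
    _ ≤ ∫⁻ x in ⋃ z ∈ c, Metric.closedBall z (N * ρ), ENNReal.ofReal (f x) :=
        lintegral_mono_set hcov
    _ ≤ ∑ z ∈ c, ∫⁻ x in Metric.closedBall z (N * ρ), ENNReal.ofReal (f x) := by
        simp_rw [← withDensity_apply' (μ := volume) (fun x => ENNReal.ofReal (f x))]
        exact measure_biUnion_finset_le _ _
    _ ≤ ∑ _z ∈ c, ENNReal.ofReal (A * logGauge d (N * ρ)) := Finset.sum_le_sum fun z _ => hball z
    _ ≤ _ := by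
        rw [Finset.sum_const, nsmul_eq_mul, ← ENNReal.ofReal_natCast]
        gcongr

/-- For `0 < t < d - l`, `logGauge_le` with exponent `t + l` trades the logarithm for a small power;
the `ρ ^ (-l)` balls covering a tube then leave `ρ ^ t`. -/
lemma le_dimH_starProjection_iInter {d A : ℝ} {c₀ : ℝ≥0∞} (hc₀ : c₀ ≠ 0) (hA0 : 0 ≤ A)
    {f : ℕ → E → ℝ} (hf : ∀ k, IsBump (f k)) (hanti : ∀ k, tsupport (f (k + 1)) ⊆ tsupport (f k))
    (hc : ∀ k, c₀ ≤ ∫⁻ y, ENNReal.ofReal (f k y))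
    (hA : ∀ k x ρ, 0 < ρ → ρ ≤ 1 → tentMass (f k) x ρ ≤ ENNReal.ofReal (A * logGauge d ρ))
    (hE : 0 < Module.finrank ℝ E) (W : Submodule ℝ E) :
    ENNReal.ofReal (projDim W d) ≤ dimH (W.starProjection '' ⋂ k, tsupport (f k)) := by
  have hE1 : (1 : ℝ) ≤ Module.finrank ℝ E := by exact_mod_cast hE
  refine le_of_forall_lt_imp_le_of_dense fun a ha => ?_
  obtain ⟨t, hat, ht⟩ := ENNReal.lt_iff_exists_nnreal_btwn.1 ha
  refine hat.le.trans (le_dimH_of_hausdorffMeasure_ne_zero ?_)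
  have ht0 : (0 : ℝ) < t := by exact_mod_cast (zero_le.trans_lt hat)
  have htd : (t : ℝ) < d - Module.finrank ℝ (E ⧸ W) := by
    rw [← ENNReal.ofReal_coe_nnreal] at ht
    have := (ENNReal.ofReal_lt_ofReal_iff_of_nonneg t.coe_nonneg).1 ht
    rcases lt_max_iff.1 this with h | h
    · exact absurd h ht0.not_gt
    · exact h
  set N : ℝ := (Module.finrank ℝ E : ℝ) with hN
  set l : ℕ := Module.finrank ℝ (E ⧸ W) with hl
  set c : ℝ := 1 + 1 / (d - (t + l)) with hc_def
  have hc0 : 0 ≤ c := by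
    have : 0 < d - (t + l) := by linarith
    positivity
  set K : ℝ := 5 ^ l * (A * (c * N ^ ((t : ℝ) + l))) with hK
  refine hausdorffMeasure_image_iInter_ne_zero (fun k => (hf k).hasCompactSupport)
    (antitone_nat_of_succ_le hanti) W.starProjection.continuous
    (ν := fun k => volume.withDensity fun y => ENNReal.ofReal (f k y)) (K := ENNReal.ofReal K)
    (ρ₀ := 1 / N) hc₀ ENNReal.ofReal_ne_top (fun k => ?_) ht0 (by positivity) ?_
  · rw [withDensity_apply']
    refine (hc k).trans (le_of_eq ?_)
    rw [← lintegral_indicator (isClosed_tsupport _).measurableSet]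
    refine lintegral_congr fun x => ?_
    by_cases hx : x ∈ tsupport (f k)
    · rw [indicator_of_mem hx]
    · rw [indicator_of_notMem hx, image_eq_zero_of_notMem_tsupport hx, ENNReal.ofReal_zero]
  · intro k y ρ hρ hρN
    rw [le_div_iff₀ (by linarith), mul_comm] at hρN
    rw [withDensity_apply']
    refine (setLIntegral_tube_le (hf k) (hA k) hE W y hρ hρN).trans ?_
    rw [← ENNReal.ofReal_mul (by positivity), ENNReal.ofReal_rpow_of_pos hρ,
      ← ENNReal.ofReal_mul (by positivity)]
    apply ENNReal.ofReal_le_ofReal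
    have hg := logGauge_le (d := d) (t := t + l) (by linarith) (by positivity : 0 < N * ρ) hρN
    calc (5 / ρ) ^ l * (A * logGauge d (N * ρ))
        ≤ (5 / ρ) ^ l * (A * (c * (N * ρ) ^ ((t : ℝ) + l))) := by gcongr
      _ = K * ρ ^ (t : ℝ) := by
        rw [Real.mul_rpow (by positivity) hρ.le, Real.rpow_add hρ, Real.rpow_natCast, div_pow]
        field_simp
        rw [hK]; ring

theorem exists_isCompact_dimH_starProjection {d : ℝ} (hd0 : 0 < d) (hd : d < Module.finrank ℝ E)
    (V : ℕ → Submodule ℝ E) : ∃ C : Set E, C.Nonempty ∧ IsCompact C ∧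
      ∀ i, dimH ((V i).starProjection '' C) = ENNReal.ofReal (projDim (V i) d) := by
  classical
  have hE : 0 < Module.finrank ℝ E := by exact_mod_cast hd0.trans hd
  have hE' : Nontrivial E := Module.finrank_pos_iff.1 hE
  -- Unpairing makes every index recur infinitely often. The zero subspace needs no refinement, as
  -- its projection is a point, so `⊤` serves as a harmless filler.
  set V' : ℕ → Submodule ℝ E := fun k => if V k.unpair.1 = ⊥ then ⊤ else V k.unpair.1 with hV'
  have hV'0 : ∀ k, V' k ≠ ⊥ := by
    intro k
    simp only [hV']
    split_ifs with h
    · exact top_ne_bot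
    · exact h
  obtain ⟨f, c₀, A, hc₀, hA0, hf⟩ := exists_bump_sequence hd V' hV'0
  have hne : ∀ k, (tsupport (f k)).Nonempty := by
    intro k
    rw [nonempty_iff_ne_empty, ne_eq, tsupport_eq_empty_iff]
    intro h0
    have := (hf k).2.2.2.1
    simp [h0, hc₀] at this
  have hcpt : ∀ k, IsCompact (tsupport (f k)) := fun k => (hf k).1.hasCompactSupport
  refine ⟨⋂ k, tsupport (f k), ?_, ?_, fun i => le_antisymm ?_ ?_⟩
  · exact IsCompact.nonempty_iInter_of_sequence_nonempty_isCompact_isClosed _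
      (fun k => (hf k).2.1) hne (hcpt 0) fun k => isClosed_tsupport _
  · exact (hcpt 0).of_isClosed_subset (isClosed_iInter fun k => isClosed_tsupport _)
      (iInter_subset _ 0)
  · by_cases hi : V i = ⊥
    · refine le_of_eq_of_le (dimH_subsingleton ?_) zero_le
      rintro _ ⟨x, -, rfl⟩ _ ⟨y, -, rfl⟩
      rw [hi, Submodule.starProjection_bot]; rfl
    · refine dimH_le_of_hasFineCover (projDim_nonneg _ _) fun δ hδ τ hτ => ?_
      obtain ⟨p, hp⟩ := exists_pow_lt_of_lt_one (lt_min hδ (sub_pos.2 hτ))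
        (by norm_num : (1 / 2 : ℝ) < 1)
      -- A visit to `V i` at a time `k ≥ p`, late enough for the tolerance required.
      set k := Nat.pair i p
      have hk : V' k = V i := by simp [hV', k, hi]
      have hpk : (1 / 2 : ℝ) ^ (k + 1) ≤ (1 / 2) ^ p :=
        pow_le_pow_of_le_one (by norm_num) (by norm_num)
          ((Nat.right_le_pair i p).trans k.le_succ)
      have hk2 : (1 / 2 : ℝ) ^ (k + 1) ≤ 1 / 2 :=
        pow_le_of_le_one (by norm_num) (by norm_num) k.succ_ne_zero
      have h := (hf k).2.2.1
      rw [hk] at h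
      refine h.mono (image_mono (iInter_subset _ _)) ?_ (by linarith)
        (add_nonneg (projDim_nonneg _ _) (by positivity)) ?_
      · linarith [min_le_left δ (τ - projDim (V i) d)]
      · linarith [min_le_right δ (τ - projDim (V i) d)]
  · exact le_dimH_starProjection_iInter hc₀ hA0 (fun k => (hf k).1) (fun k => (hf k).2.1)
      (fun k => (hf k).2.2.2.1) (fun k => (hf k).2.2.2.2) hE (V i)

omit [MeasurableSpace E] [BorelSpace E] in
lemma dimH_starProjection_closedBall (W : Submodule ℝ E) :
    dimH (W.starProjection '' Metric.closedBall 0 1) = Module.finrank ℝ W := by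
  have h1 : W.starProjection '' Metric.closedBall 0 1 =
      (Subtype.val : W → E) '' Metric.closedBall 0 1 := by
    ext x
    constructor
    · rintro ⟨y, hy, rfl⟩
      refine ⟨W.orthogonalProjectionOnto y, ?_, rfl⟩
      rw [mem_closedBall_zero_iff] at hy ⊢
      exact (W.norm_orthogonalProjectionOnto_apply_le y).trans hy
    · rintro ⟨y, hy, rfl⟩
      refine ⟨y, by simpa using hy, ?_⟩
      exact Submodule.starProjection_eq_self_iff.2 y.2
  rw [h1, Isometry.dimH_image isometry_subtype_coe]
  exact Real.dimH_of_nonempty_interior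
    ⟨0, mem_interior_iff_mem_nhds.2 (Metric.closedBall_mem_nhds 0 one_pos)⟩

end Construction

/-! ### The endpoint cases and the conclusion. -/

theorem claim2p4 (n : ℕ) {ι : Type*} [Countable ι]
    (W : ι → Submodule ℝ (EuclideanSpace ℝ (Fin n))) (l : ι → ℕ)
    (hl : ∀ i, Module.finrank ℝ (EuclideanSpace ℝ (Fin n) ⧸ W i) = l i)
    (d : ℝ) (hd : d ∈ Set.Icc (0 : ℝ) (n : ℝ)) :
    ∃ C : Set (EuclideanSpace ℝ (Fin n)), C.Nonempty ∧ IsCompact C ∧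
      dimH C = ENNReal.ofReal d ∧
      ∀ i, dimH ((W i).starProjection '' C) = ENNReal.ofReal (max 0 (d - (l i : ℝ))) := by
  have htop : ∀ C : Set (EuclideanSpace ℝ (Fin n)),
      (⊤ : Submodule ℝ (EuclideanSpace ℝ (Fin n))).starProjection '' C = C := fun C => by
    simp [Submodule.starProjection_top']
  rcases hd.1.eq_or_lt with rfl | hd0
  · refine ⟨{0}, singleton_nonempty 0, isCompact_singleton, by simp, fun i => ?_⟩
    rw [image_singleton, dimH_singleton, max_eq_left (by simp), ENNReal.ofReal_zero]
  rcases hd.2.eq_or_lt with rfl | hdn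
  · refine ⟨Metric.closedBall 0 1, ⟨0, by simp⟩, isCompact_closedBall 0 1, ?_, fun i => ?_⟩
    · rw [← htop (Metric.closedBall 0 1), dimH_starProjection_closedBall]
      simp
    · have h1 := (W i).finrank_quotient_add_finrank
      rw [hl, finrank_euclideanSpace_fin] at h1
      have h2 : (n : ℝ) - l i = Module.finrank ℝ (W i) := by
        rw [sub_eq_iff_eq_add']; exact_mod_cast h1.symm
      rw [dimH_starProjection_closedBall, h2]
      simp
  -- The extra index `none` carries the whole space, whose projection is the identity; it yields
  -- `dimH C` and also makes the index type nonempty.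
  · obtain ⟨g, hg⟩ := exists_surjective_nat (Option ι)
    set U : Option ι → Submodule ℝ (EuclideanSpace ℝ (Fin n)) := fun o => o.elim ⊤ W with hU
    obtain ⟨C, hC1, hC2, hC3⟩ := exists_isCompact_dimH_starProjection hd0
      (by rwa [finrank_euclideanSpace_fin]) fun k => U (g k)
    have hC4 : ∀ o, dimH ((U o).starProjection '' C) = ENNReal.ofReal (projDim (U o) d) := by
      intro o
      obtain ⟨k, rfl⟩ := hg o
      exact hC3 k
    refine ⟨C, hC1, hC2, ?_, fun i => ?_⟩
    · have := hC4 none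
      simp only [hU, Option.elim_none, htop] at this
      rw [this, projDim]
      congr 1
      simp [Module.finrank_zero_of_subsingleton, hd0.le]
    · have := hC4 (some i)
      simp only [hU, Option.elim_some] at this
      rw [this, projDim, hl]
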